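/- Let $A$ be a finite dimensional algebra over a field $k$, and let $\operatorname{mod} A$ be the category of finite dimensional left $A$-modules. All subcategories of $\operatorname{mod} A$ are full and closed under isomorphisms, and modules are considered up to isomorphism. For a module $T$, let $\operatorname{Gen} T$ be the class of factor modules of finite direct sums $T^n$, let $\operatorname{add} T$ be the class of direct summands of the modules $T^n$, and let $T^{\perp}=\{Y\mid \operatorname{Hom}_A(T,Y)=0\}$. For a subcategory $\mathcal X$, let ${}^{\perp_1}\mathcal X=\{Y\mid \operatorname{Ext}^1_A(Y,X)=0 \text{ for all } X\in\mathcal X\}$. A module is basic if it is a direct sum of pairwise non-isomorphic indecomposable modules. Let $\tau=D\operatorname{Tr}$ be the Auslander–Reiten translation. A module $M$ is $\tau$-tilting if $\operatorname{Hom}_A(M,\tau M)=0$ and the number of isomorphism classes of indecomposable direct summands of $M$ equals the number of isomorphism classes of simple $A$-modules; it is support $\tau$-tilting if, for some idempotent $e\in A$, it is a $\tau$-tilting module over $A/AeA$. A module $T$ is tilting if it has projective dimension at most $1$, $\operatorname{Ext}^1_A(T,T)=0$, and there is an exact sequence $0\to A\to T_0\to T_1\to 0$ with $T_0,T_1\in\operatorname{add}T$.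 A pair $(\mathcal C,\mathcal T)$ of subcategories, both closed under direct summands, is a left weak cotorsion pair if $\operatorname{Ext}^1_A(C,T)=0$ for all $C\in\mathcal C$, $T\in\mathcal T$, and for every $M\in\operatorname{mod}A$ there are exact sequences $$0\to Y_M\to X_M\xrightarrow{f_M} M\to 0\qquad\text{and}\qquad M\xrightarrow{g^M} Y^M\to X^M\to 0$$ with $X_M,X^M\in\mathcal C$, $Y_M,Y^M\in\mathcal T$, $f_M$ a right $\mathcal C$-approximation and $g^M$ a left $\mathcal T$-approximation of $M$. It is a (complete) cotorsion pair if, moreover, $g^M$ can be chosen injective for every $M$. A pair $(\mathcal T,\mathcal F)$ is a torsion pair if $\mathcal T=\{X\mid \operatorname{Hom}_A(X,F)=0\ \text{for all } F\in\mathcal F\}$ and $\mathcal F=\{Y\mid \operatorname{Hom}_A(T,Y)=0\ \text{for all } T\in\mathcal T\}$. A triple $(\mathcal C,\mathcal T,\mathcal F)$ is an lw-cotorsion-torsion triple (respectively, a cotorsion-torsion triple) if $(\mathcal C,\mathcal T)$ is a left weak cotorsion pair (respectively, a cotorsion pair) and $(\mathcal T,\mathcal F)$ is a torsion pair. **Theorem.**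 The map $T\mapsto({}^{\perp_1}\operatorname{Gen}T,\ \operatorname{Gen}T,\ T^{\perp})$ is a bijection from isomorphism classes of basic support $\tau$-tilting $A$-modules to lw-cotorsion-torsion triples. Its inverse sends $(\mathcal C,\mathcal T,\mathcal F)$ to the basic module $T$ with $\operatorname{add}T=\mathcal C\cap\mathcal T$: a basic module $T$ satisfies $\operatorname{add}T=\mathcal C\cap\mathcal T$ if and only if $T$ is support $\tau$-tilting and is mapped to $(\mathcal C,\mathcal T,\mathcal F)$. Every basic tilting module is support $\tau$-tilting, and the map restricts to a bijection from isomorphism classes of basic tilting modules to cotorsion-torsion triples. -/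

import Mathlib

open CategoryTheory

universe v u

namespace WeakCotorsion

section ProjectiveCovers

variable {A : Type u} [Ring A]

/-- A submodule `N` of `M` is superfluous if `L + N = M` implies `L = M`. -/
def IsSuperfluous {M : Type*} [AddCommGroup M] [Module A M] (N : Submodule A M) : Prop :=
  ∀ L : Submodule A M, L ⊔ N = ⊤ → L = ⊤

/-- A projective cover: an epimorphism from a projective module with superfluous kernel. -/
structure IsProjectiveCover {P M : Type*} [AddCommGroup P] [Module A P] [AddCommGroup M]
    [Module A M] (f : P →ₗ[A] M) : Prop where
  projective : Module.Projective A P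
  surjective : Function.Surjective f
  superfluous : IsSuperfluous (LinearMap.ker f)

theorem exists_projectiveCover [IsArtinianRing A] (M : FGModuleCat.{u} A) :
    ∃ (P : FGModuleCat.{u} A) (f : P →ₗ[A] M), IsProjectiveCover f := by
  obtain ⟨n, F, hF⟩ := Module.Finite.exists_fin' A M
  let S : Set (Submodule A (Fin n → A)) :=
    {Q | Module.Projective A Q ∧ Function.Surjective (F.domRestrict Q)}
  have hS : S.Nonempty := by
    refine ⟨⊤, Module.Projective.of_equiv (Submodule.topEquiv (R := A)).symm, fun m => ?_⟩
    obtain ⟨x, hx⟩ := hF m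
    exact ⟨⟨x, trivial⟩, hx⟩
  obtain ⟨Q, ⟨hQp, hQs⟩, hmin⟩ := WellFounded.has_min (wellFounded_lt) S hS
  refine ⟨FGModuleCat.of A Q, F.domRestrict Q, hQp, hQs, fun N hN => ?_⟩
  set f : Q →ₗ[A] M := F.domRestrict Q with hf
  have hN' : Function.Surjective (f.domRestrict N) := by
    intro m
    obtain ⟨q, rfl⟩ := hQs m
    have hq : q ∈ N ⊔ LinearMap.ker f := by
      rw [hN]; trivial
    obtain ⟨y, hy, z, hz, rfl⟩ := Submodule.mem_sup.1 hq
    refine ⟨⟨y, hy⟩, ?_⟩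
    have hz' : f z = 0 := hz
    simp [hz']
  obtain ⟨g, hg⟩ := Module.projective_lifting_property (f.domRestrict N) f hN'
  let h : Module.End A Q := N.subtype ∘ₗ g
  have hfh : ∀ x, f (h x) = f x := fun x => LinearMap.congr_fun hg x
  have hpow : ∀ (i : ℕ) x, f ((h ^ i) x) = f x := by
    intro i
    induction i with
    | zero => intro x; simp
    | succ i ih => intro x; rw [pow_succ', Module.End.mul_apply, hfh, ih]
  obtain ⟨i, hi, hi1⟩ := ((h.eventually_isCompl_ker_pow_range_pow).and
    (Filter.eventually_ge_atTop 1)).exists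
  have hR : Module.Projective A (LinearMap.range (h ^ i)) :=
    Module.Projective.of_split (LinearMap.range (h ^ i)).subtype
      (Submodule.projectionOnto _ _ hi.symm)
      (LinearMap.ext fun x => Submodule.projectionOnto_apply_left hi.symm x)
  let R' : Submodule A (Fin n → A) := (LinearMap.range (h ^ i)).map Q.subtype
  have hR' : R' ∈ S := by
    refine ⟨Module.Projective.of_equiv
      (Submodule.equivMapOfInjective Q.subtype Q.injective_subtype _), fun m => ?_⟩
    obtain ⟨q, rfl⟩ := hQs m
    refine ⟨⟨((h ^ i) q : Q), Submodule.mem_map_of_mem ⟨q, rfl⟩⟩, ?_⟩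
    exact hpow i q
  have hle : R' ≤ Q := Submodule.map_subtype_le _ _
  have hEq : R' = Q := by
    by_contra hne
    exact hmin R' hR' (lt_of_le_of_ne hle hne)
  rw [eq_top_iff]
  intro x _
  have hx : (x : Fin n → A) ∈ R' := by
    rw [hEq]
    exact Subtype.property (p := fun y => y ∈ Q) x
  obtain ⟨y, ⟨z, rfl⟩, hy⟩ := hx
  have hxy : (h ^ i) z = x := Subtype.ext hy
  obtain ⟨j, hj⟩ : ∃ j, i = j + 1 := ⟨i - 1, by omega⟩
  have hmem : (h ^ i) z ∈ N := by
    rw [hj, pow_succ', Module.End.mul_apply]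
    exact (g _).2
  exact hxy ▸ hmem

/-- A minimal projective presentation `P₁ → P₀ → M → 0`: exact, with `P₀ → M` and
`P₁ → im (P₁ → P₀) = ker (P₀ → M)` projective covers. -/
structure MinimalPresentation (M : FGModuleCat.{u} A) where
  P₀ : FGModuleCat.{u} A
  P₁ : FGModuleCat.{u} A
  d : P₁ →ₗ[A] P₀
  π : P₀ →ₗ[A] M
  exact : Function.Exact d π
  cover₀ : IsProjectiveCover π
  cover₁ : IsProjectiveCover d.rangeRestrict

theorem nonempty_minimalPresentation [IsArtinianRing A] (M : FGModuleCat.{u} A) :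
    Nonempty (MinimalPresentation M) := by
  obtain ⟨P₀, π, hπ⟩ := exists_projectiveCover M
  obtain ⟨P₁, f, hf⟩ := exists_projectiveCover (FGModuleCat.of A (LinearMap.ker π))
  let d : P₁ →ₗ[A] P₀ := (LinearMap.ker π).subtype ∘ₗ f
  refine ⟨⟨P₀, P₁, d, π, ?_, hπ, hf.projective, d.surjective_rangeRestrict, ?_⟩⟩
  · intro x
    constructor
    · intro hx
      obtain ⟨y, hy⟩ := hf.surjective ⟨x, hx⟩
      exact ⟨y, congrArg Subtype.val hy⟩
    · rintro ⟨y, rfl⟩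
      exact (f y).2
  · have hk : LinearMap.ker d.rangeRestrict = LinearMap.ker f := by
      rw [LinearMap.ker_rangeRestrict]
      exact LinearMap.ker_comp_of_ker_eq_bot f (Submodule.ker_subtype _)
    rw [hk]
    exact hf.superfluous

end ProjectiveCovers

section AuslanderReitenTranslation

/-- The `k`-dual `D X = Hom_k(X, k)` of a right `A`-module `X`, a left `A`-module through
`(a • φ) x = φ (x • a)`. -/
def KDual (k : Type v) (A : Type u) (X : Type*) [Field k] [Ring A] [AddCommGroup X] [Module k X]
    [Module Aᵐᵒᵖ X] [SMulCommClass Aᵐᵒᵖ k X] := X →ₗ[k] k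

section KDual

variable (k : Type v) (A : Type u) (X : Type*) [Field k] [Ring A] [AddCommGroup X] [Module k X]
  [Module Aᵐᵒᵖ X] [SMulCommClass Aᵐᵒᵖ k X]

instance : AddCommGroup (KDual k A X) := inferInstanceAs (AddCommGroup (X →ₗ[k] k))

instance : FunLike (KDual k A X) X k := inferInstanceAs (FunLike (X →ₗ[k] k) X k)

instance : Module A (KDual k A X) where
  smul a φ := LinearMap.comp (φ : X →ₗ[k] k)
    (DistribSMul.toLinearMap k X (MulOpposite.op a))
  one_smul φ := LinearMap.ext fun x => congrArg (φ : X →ₗ[k] k) (one_smul Aᵐᵒᵖ x)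
  mul_smul a b φ := LinearMap.ext fun x => congrArg (φ : X →ₗ[k] k)
    (mul_smul (MulOpposite.op b) (MulOpposite.op a) x)
  smul_zero _ := rfl
  smul_add _ _ _ := rfl
  add_smul a b φ := LinearMap.ext fun x => by
    exact (congrArg (φ : X →ₗ[k] k) (add_smul (MulOpposite.op a) (MulOpposite.op b) x)).trans
      (LinearMap.map_add (φ : X →ₗ[k] k) _ _)
  zero_smul φ := LinearMap.ext fun x => by
    exact (congrArg (φ : X →ₗ[k] k) (zero_smul Aᵐᵒᵖ x)).trans (LinearMap.map_zero (φ : X →ₗ[k] k))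

theorem KDual.smul_apply (a : A) (φ : KDual k A X) (x : X) :
    (a • φ) x = φ (MulOpposite.op a • x) := rfl

end KDual

/-- The map `Hom_A(d, A) : Hom_A(P₀, A) → Hom_A(P₁, A)` of right `A`-modules. -/
def homDual {A : Type u} [Ring A] {P₀ P₁ : Type*} [AddCommGroup P₀] [Module A P₀]
    [AddCommGroup P₁] [Module A P₁] (d : P₁ →ₗ[A] P₀) :
    (P₀ →ₗ[A] A) →ₗ[Aᵐᵒᵖ] (P₁ →ₗ[A] A) where
  toFun g := g ∘ₗ d
  map_add' _ _ := rfl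
  map_smul' _ _ := rfl

/-- The Auslander-Bridger transpose `Tr M`, a right `A`-module, computed from a minimal projective
presentation: the cokernel of `Hom_A(P₀, A) → Hom_A(P₁, A)`. -/
abbrev MinimalPresentation.Tr {A : Type u} [Ring A] {M : FGModuleCat.{u} A}
    (P : MinimalPresentation M) : Type u :=
  (P.P₁ →ₗ[A] A) ⧸ LinearMap.range (homDual P.d)

variable (k : Type v) [Field k] {A : Type u} [Ring A] [Algebra k A] [Module.Finite k A]

/-- A chosen minimal projective presentation (they are all isomorphic). -/
noncomputable def minimalPresentation (M : FGModuleCat.{u} A) : MinimalPresentation M :=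
  haveI : IsArtinianRing A := IsArtinianRing.of_finite k A
  (nonempty_minimalPresentation M).some

/-- The Auslander-Reiten translate `τ M = D Tr M`. -/
abbrev tau (M : FGModuleCat.{u} A) : Type (max u v) :=
  KDual k A (minimalPresentation k M).Tr

end AuslanderReitenTranslation

section Modules

variable {A : Type u} [Ring A]

/-- Isomorphism classes of finitely generated left `A`-modules. -/
abbrev IsoClass (A : Type u) [Ring A] : Type (u + 1) :=
  Quotient (isIsomorphicSetoid (FGModuleCat.{u} A))

/-- The isomorphism class of a module. -/
def isoClass (M : FGModuleCat.{u} A) : IsoClass A := Quotient.mk _ M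

/-- `X` is (isomorphic to) a direct summand of `M`. -/
def IsDirectSummand (X M : Type*) [AddCommGroup X] [Module A X] [AddCommGroup M] [Module A M] :
    Prop :=
  ∃ (i : X →ₗ[A] M) (r : M →ₗ[A] X), r ∘ₗ i = LinearMap.id

/-- A module is indecomposable if it is nonzero and not a direct sum of two nonzero submodules. -/
def IsIndecomposable (M : FGModuleCat.{u} A) : Prop :=
  Nontrivial M ∧ ∀ N L : Submodule A M, IsCompl N L → N = ⊥ ∨ L = ⊥

/-- A module is basic if it is a finite direct sum of pairwise non-isomorphic indecomposables. -/
def IsBasic (M : FGModuleCat.{u} A) : Prop :=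
  ∃ (n : ℕ) (X : Fin n → FGModuleCat.{u} A), (∀ i, IsIndecomposable (X i)) ∧
    (∀ i j, Nonempty (X i ≃ₗ[A] X j) → i = j) ∧ Nonempty (M ≃ₗ[A] ∀ i, X i)

/-- The number of isomorphism classes of indecomposable direct summands of `M`. -/
noncomputable def numIndecomposableSummands (M : FGModuleCat.{u} A) : ℕ∞ :=
  Set.encard {c : IsoClass A | ∃ X : FGModuleCat.{u} A, isoClass X = c ∧ IsIndecomposable X ∧
    IsDirectSummand (A := A) X M}

/-- The number of isomorphism classes of simple `A`-modules. -/
noncomputable def numSimples (A : Type u) [Ring A] : ℕ∞ :=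
  Set.encard {c : IsoClass A | ∃ S : FGModuleCat.{u} A, isoClass S = c ∧ IsSimpleModule A S}

/-- `M` is τ-tilting: `Hom(M, τ M) = 0`, and `M` has as many indecomposable direct summands (up to
isomorphism) as there are simple modules. -/
def IsTauTilting (k : Type v) [Field k] [Algebra k A] [Module.Finite k A]
    (M : FGModuleCat.{u} A) : Prop :=
  (∀ f : M →ₗ[A] tau k M, f = 0) ∧ numIndecomposableSummands M = numSimples A

/-- The two-sided ideal `A e A`. -/
def idealGen (e : A) : Ideal A := (TwoSidedIdeal.span {e}).asIdeal

instance (e : A) : (idealGen e).IsTwoSided :=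
  inferInstanceAs ((TwoSidedIdeal.span {e}).asIdeal).IsTwoSided

/-- `M` is support τ-tilting: for some idempotent `e`, it is (the restriction to `A` of) a τ-tilting
module over `A / A e A`. -/
def IsSupportTauTilting (k : Type v) [Field k] [Algebra k A] [Module.Finite k A]
    (M : FGModuleCat.{u} A) : Prop :=
  ∃ e : A, IsIdempotentElem e ∧ ∃ N : FGModuleCat.{u} (A ⧸ idealGen e),
    IsTauTilting k N ∧
      ∃ φ : M →ₛₗ[Ideal.Quotient.mk (idealGen e)] N, Function.Bijective φ

/-- `Ext¹(X, Y) = 0`. -/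
def ExtOneVanishes (X Y : FGModuleCat.{u} A) : Prop :=
  Subsingleton (Abelian.Ext X.obj Y.obj 1)

end Modules

section Subcategories

variable {A : Type u} [Ring A]

/-- `Gen T`: the factor modules of finite direct sums of copies of `T`. -/
def Gen (T : FGModuleCat.{u} A) : ObjectProperty (FGModuleCat.{u} A) := fun X =>
  ∃ (n : ℕ) (f : (Fin n → T) →ₗ[A] X), Function.Surjective f

/-- `add T`: the direct summands of finite direct sums of copies of `T`. -/
def addClosure (T : FGModuleCat.{u} A) : ObjectProperty (FGModuleCat.{u} A) := fun X =>
  ∃ n : ℕ, IsDirectSummand (A := A) X (Fin n → T)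

/-- `T^⊥ = {Y | Hom(T, Y) = 0}`. -/
def homPerp (T : FGModuleCat.{u} A) : ObjectProperty (FGModuleCat.{u} A) := fun Y =>
  ∀ f : T →ₗ[A] Y, f = 0

/-- `^{⊥₁}𝒳 = {Y | Ext¹(Y, 𝒳) = 0}`. -/
def extPerp (𝒳 : ObjectProperty (FGModuleCat.{u} A)) : ObjectProperty (FGModuleCat.{u} A) :=
  fun Y => ∀ X, 𝒳 X → ExtOneVanishes Y X

/-- `f : X → M` is a right `𝒞`-approximation of `M`. -/
def IsRightApprox (𝒞 : ObjectProperty (FGModuleCat.{u} A)) {X M : FGModuleCat.{u} A}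
    (f : X →ₗ[A] M) : Prop :=
  𝒞 X ∧ ∀ X', 𝒞 X' → ∀ h : X' →ₗ[A] M, ∃ h' : X' →ₗ[A] X, f ∘ₗ h' = h

/-- `g : M → Y` is a left `𝒯`-approximation of `M`. -/
def IsLeftApprox (𝒯 : ObjectProperty (FGModuleCat.{u} A)) {M Y : FGModuleCat.{u} A}
    (g : M →ₗ[A] Y) : Prop :=
  𝒯 Y ∧ ∀ Y', 𝒯 Y' → ∀ h : M →ₗ[A] Y', ∃ h' : Y →ₗ[A] Y', h' ∘ₗ g = h

/-- There is an exact sequence `0 → Y → X → M → 0` with `Y` in `𝒯`, `X` in `𝒞` and `X → M` a right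
`𝒞`-approximation. -/
def HasRightSequence (𝒞 𝒯 : ObjectProperty (FGModuleCat.{u} A)) (M : FGModuleCat.{u} A) : Prop :=
  ∃ (X Y : FGModuleCat.{u} A) (i : Y →ₗ[A] X) (f : X →ₗ[A] M), 𝒞 X ∧ 𝒯 Y ∧
    Function.Injective i ∧ Function.Exact i f ∧ Function.Surjective f ∧ IsRightApprox 𝒞 f

/-- `g : M → Y` is a left `𝒯`-approximation that extends to an exact sequence `M → Y → X → 0` with
`Y` in `𝒯` and `X` in `𝒞`. -/
def IsLeftSequence (𝒞 𝒯 : ObjectProperty (FGModuleCat.{u} A)) {M Y : FGModuleCat.{u} A}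
    (g : M →ₗ[A] Y) : Prop :=
  ∃ (X : FGModuleCat.{u} A) (p : Y →ₗ[A] X), 𝒞 X ∧ 𝒯 Y ∧
    Function.Exact g p ∧ Function.Surjective p ∧ IsLeftApprox 𝒯 g

/-- `(𝒞, 𝒯)` is a left weak cotorsion pair. Both classes are full subcategories closed under direct
summands (in particular under isomorphisms). -/
structure IsLeftWeakCotorsionPair (𝒞 𝒯 : ObjectProperty (FGModuleCat.{u} A)) : Prop where
  summands_left : 𝒞.IsStableUnderRetracts
  summands_right : 𝒯.IsStableUnderRetracts
  ext_vanishes : ∀ X Y, 𝒞 X → 𝒯 Y → ExtOneVanishes X Y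
  right_sequence : ∀ M, HasRightSequence 𝒞 𝒯 M
  left_sequence : ∀ M : FGModuleCat.{u} A, ∃ (Y : FGModuleCat.{u} A) (g : M →ₗ[A] Y),
    IsLeftSequence 𝒞 𝒯 g

/-- `(𝒞, 𝒯)` is a (complete) cotorsion pair: a left weak cotorsion pair in which the left
approximations can be chosen injective. -/
structure IsCotorsionPair (𝒞 𝒯 : ObjectProperty (FGModuleCat.{u} A)) : Prop
    extends IsLeftWeakCotorsionPair 𝒞 𝒯 where
  left_sequence_injective : ∀ M : FGModuleCat.{u} A, ∃ (Y : FGModuleCat.{u} A) (g : M →ₗ[A] Y),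
    IsLeftSequence 𝒞 𝒯 g ∧ Function.Injective g

/-- `(𝒯, ℱ)` is a torsion pair: each class is the `Hom`-orthogonal of the other. -/
structure IsTorsionPair (𝒯 ℱ : ObjectProperty (FGModuleCat.{u} A)) : Prop where
  torsion_iff : ∀ X, 𝒯 X ↔ ∀ Y, ℱ Y → ∀ f : X →ₗ[A] Y, f = 0
  torsionFree_iff : ∀ Y, ℱ Y ↔ ∀ X, 𝒯 X → ∀ f : X →ₗ[A] Y, f = 0

/-- A triple `(𝒞, 𝒯, ℱ)` of full subcategories of `mod A`. -/
@[ext]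
structure SubcatTriple (A : Type u) [Ring A] where
  C : ObjectProperty (FGModuleCat.{u} A)
  T : ObjectProperty (FGModuleCat.{u} A)
  F : ObjectProperty (FGModuleCat.{u} A)

/-- Left weak cotorsion-torsion triples. -/
def IsLwCotorsionTorsion (t : SubcatTriple A) : Prop :=
  IsLeftWeakCotorsionPair t.C t.T ∧ IsTorsionPair t.T t.F

/-- Cotorsion-torsion triples. -/
def IsCotorsionTorsion (t : SubcatTriple A) : Prop :=
  IsCotorsionPair t.C t.T ∧ IsTorsionPair t.T t.F

/-- `T` is a (classical) tilting module: `pd T ≤ 1`, `Ext¹(T, T) = 0`, and there is an exact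
sequence `0 → A → T₀ → T₁ → 0` with `T₀`, `T₁` in `add T`. -/
structure IsTilting (T : FGModuleCat.{u} A) : Prop where
  projectiveDimension_le_one : HasProjectiveDimensionLE T.obj 1
  ext_self : ExtOneVanishes T T
  coresolution : ∃ (T₀ T₁ : FGModuleCat.{u} A) (i : A →ₗ[A] T₀) (p : T₀ →ₗ[A] T₁),
    addClosure T T₀ ∧ addClosure T T₁ ∧
      Function.Injective i ∧ Function.Exact i p ∧ Function.Surjective p

/-- The triple `(^{⊥₁}Gen T, Gen T, T^⊥)`. -/
def tripleOf (T : FGModuleCat.{u} A) : SubcatTriple A := ⟨extPerp (Gen T), Gen T, homPerp T⟩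

theorem gen_le_of_equiv {T T' : FGModuleCat.{u} A} (e : T ≃ₗ[A] T') : Gen T ≤ Gen T' := by
  rintro X ⟨n, f, hf⟩
  refine ⟨n, f ∘ₗ (LinearEquiv.piCongrRight fun _ => e.symm).toLinearMap, ?_⟩
  exact hf.comp (LinearEquiv.surjective _)

theorem homPerp_le_of_equiv {T T' : FGModuleCat.{u} A} (e : T ≃ₗ[A] T') :
    homPerp T ≤ homPerp T' := by
  intro Y hY f
  have h := hY (f ∘ₗ e.toLinearMap)
  ext x
  simpa using LinearMap.congr_fun h (e.symm x)

theorem tripleOf_eq_of_iso {T T' : FGModuleCat.{u} A} (i : T ≅ T') : tripleOf T = tripleOf T' := by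
  have e := FGModuleCat.isoToLinearEquiv i
  have hG : Gen T = Gen T' := le_antisymm (gen_le_of_equiv e) (gen_le_of_equiv e.symm)
  have hP : homPerp T = homPerp T' := le_antisymm (homPerp_le_of_equiv e)
    (homPerp_le_of_equiv e.symm)
  rw [tripleOf, tripleOf, hG, hP]

/-- The map `T ↦ (^{⊥₁}Gen T, Gen T, T^⊥)` on isomorphism classes of modules. -/
def tripleMap : IsoClass A → SubcatTriple A :=
  Quotient.lift tripleOf fun _ _ ⟨i⟩ => tripleOf_eq_of_iso i

/-- The isomorphism classes of basic support τ-tilting modules. -/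
def basicSupportTauTilting (k : Type v) (A : Type u) [Field k] [Ring A] [Algebra k A]
    [Module.Finite k A] : Set (IsoClass A) :=
  isoClass '' {T : FGModuleCat.{u} A | IsBasic T ∧ IsSupportTauTilting k T}

/-- The isomorphism classes of basic tilting modules. -/
def basicTilting (A : Type u) [Ring A] : Set (IsoClass A) :=
  isoClass '' {T : FGModuleCat.{u} A | IsBasic T ∧ IsTilting T}

end Subcategories

end WeakCotorsion

namespace WeakCotorsion

/-!
Call `T` silting if `Ext¹(T, Gen T) = 0` and `A` has a left `Gen T`-approximation `A → T₀` whose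
cokernel `T₁` lies in `add T`, with `T₀` in `add T`. Over an artinian ring these are the modules
parametrizing the triples. Pushing powers of `A → T₀ → T₁ → 0` out along presentations of an
arbitrary module gives the approximation sequences of a left weak cotorsion pair
`(^{⊥₁}Gen T, Gen T)`. Conversely, the approximation `A → Y → X → 0` in a triple `(𝒞, 𝒯, ℱ)`
satisfies `add (Y ⊕ X) = 𝒞 ∩ 𝒯`, and the triple is recovered from `𝒯 = Gen Y`.

The Auslander–Reiten formula turns `Hom(M, τ M) = 0` into `Ext¹(M, Gen M) = 0`. Such an `M` is
completed to a silting module by a universal extension, so what remains is to count indecomposable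
summands. Functions on `mod A` that are additive on short exact sequences are determined by their
values on the simple modules, and `dim Hom(Tᵢ, -)` extends from `Gen T` to such a function. The
`dim Hom(Tᵢ, -)` are linearly independent on `Gen T`, which bounds the number of summands by the
number of simple modules, and for silting `T` the `dim Hom(P, -)` with `P` projective are
combinations of them on `Gen T`, which gives equality if every simple module embeds into a module
in `Gen T`.

A silting module `M` is `τ`-tilting over `A ⧸ AeA`, where `e` is an idempotent annihilating `M` with
`Ae` as large as possible, and silting modules over `A ⧸ AeA` are silting over `A` because `AeA` is
an idempotent ideal.
-/

/-! ### Short exact sequences, pushouts and `Ext¹` -/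

section ShortExact

variable {A : Type*} [Ring A] {X Y Z W : Type*} [AddCommGroup X] [Module A X] [AddCommGroup Y]
  [Module A Y] [AddCommGroup Z] [Module A Z] [AddCommGroup W] [Module A W]

/-- `0 → X → Y → Z → 0` is a short exact sequence of modules, in terms of functions rather than of
morphisms in a category, as in the classes of modules above. -/
structure IsShortExact (i : X →ₗ[A] Y) (p : Y →ₗ[A] Z) : Prop where
  injective : Function.Injective i
  exact : Function.Exact i p
  surjective : Function.Surjective p

theorem isShortExact_subtype_ker {p : Y →ₗ[A] Z} (hp : Function.Surjective p) :
    IsShortExact (LinearMap.ker p).subtype p :=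
  ⟨Subtype.val_injective, LinearMap.exact_subtype_ker_map p, hp⟩

theorem isShortExact_subtype_mkQ (N : Submodule A Y) : IsShortExact N.subtype N.mkQ :=
  ⟨Subtype.val_injective, LinearMap.exact_subtype_mkQ N, N.mkQ_surjective⟩

theorem isShortExact_inl_snd : IsShortExact (LinearMap.inl A X Y) (LinearMap.snd A X Y) :=
  ⟨LinearMap.inl_injective, Function.Exact.inl_snd, LinearMap.snd_surjective⟩

theorem IsShortExact.exists_retraction {i : X →ₗ[A] Y} {p : Y →ₗ[A] Z} (h : IsShortExact i p)
    {s : Z →ₗ[A] Y} (hs : p ∘ₗ s = LinearMap.id) : ∃ r : Y →ₗ[A] X, r ∘ₗ i = LinearMap.id := by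
  have hsr := (h.exact.split_tfae h.injective h.surjective).out 0 1
  exact hsr.1 ⟨s, hs⟩

theorem exists_comp_eq_of_exact {f : X →ₗ[A] Y} {p : Y →ₗ[A] Z} (hfp : Function.Exact f p)
    (hp : Function.Surjective p) (g : Y →ₗ[A] W) (hg : g ∘ₗ f = 0) :
    ∃ u : Z →ₗ[A] W, u ∘ₗ p = g := by
  refine ⟨(LinearMap.range f).liftQ g (LinearMap.range_le_ker_iff.2 hg) ∘ₗ
    (hfp.linearEquivOfSurjective hp).symm.toLinearMap, LinearMap.ext fun y => ?_⟩
  have hy : (hfp.linearEquivOfSurjective hp).symm (p y) = Submodule.Quotient.mk y :=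
    hfp.linearEquivOfSurjective_symm_apply hp y
  simp [hy]

theorem exact_compLeft {f : X →ₗ[A] Y} {p : Y →ₗ[A] Z} (hfp : Function.Exact f p) (n : ℕ) :
    Function.Exact (f.compLeft (Fin n)) (p.compLeft (Fin n)) := fun y => by
  constructor
  · intro hy
    choose z hz using fun i => (hfp (y i)).1 (congrFun hy i)
    exact ⟨z, funext hz⟩
  · rintro ⟨z, rfl⟩
    exact funext fun i => hfp.apply_apply_eq_zero (z i)

theorem exists_comp_eq_of_projective [Module.Projective A W] {f : X →ₗ[A] Y} {p : Y →ₗ[A] Z}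
    (hfp : Function.Exact f p) {g : W →ₗ[A] Y} (hg : p ∘ₗ g = 0) :
    ∃ u : W →ₗ[A] X, f ∘ₗ u = g := by
  obtain ⟨u, hu⟩ := Module.projective_lifting_property f.rangeRestrict
    (g.codRestrict (LinearMap.range f) fun w => (hfp _).1 (LinearMap.congr_fun hg w))
    f.surjective_rangeRestrict
  exact ⟨u, LinearMap.ext fun w => congrArg Subtype.val (LinearMap.congr_fun hu w)⟩

end ShortExact

section Pushout

variable {A : Type*} [Ring A] {K P L W X : Type*} [AddCommGroup K] [Module A K] [AddCommGroup P]
  [Module A P] [AddCommGroup L] [Module A L] [AddCommGroup W] [Module A W] [AddCommGroup X]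
  [Module A X]

/-- The pushout of `i : K → P` and `l : K → L`. An explicit quotient of `P × L` keeps finite
generation visible to instance search. -/
abbrev PushoutModule (i : K →ₗ[A] P) (l : K →ₗ[A] L) : Type _ :=
  (P × L) ⧸ LinearMap.range (i.prod (-l))

namespace PushoutModule

variable (i : K →ₗ[A] P) (l : K →ₗ[A] L)

/-- The structure map of the pushout from `P`. -/
def inl : P →ₗ[A] PushoutModule i l := (LinearMap.range (i.prod (-l))).mkQ ∘ₗ LinearMap.inl A P L

/-- The structure map of the pushout from `L`. -/
def inr : L →ₗ[A] PushoutModule i l := (LinearMap.range (i.prod (-l))).mkQ ∘ₗ LinearMap.inr A P L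

theorem inl_comp : inl i l ∘ₗ i = inr i l ∘ₗ l := by
  ext z
  exact (Submodule.Quotient.eq _).2 ⟨z, by simp⟩

theorem exists_inl_add_inr (e : PushoutModule i l) : ∃ x y, inl i l x + inr i l y = e := by
  obtain ⟨⟨x, y⟩, rfl⟩ := Submodule.mkQ_surjective _ e
  exact ⟨x, y, by simp [inl, inr, ← Submodule.Quotient.mk_add]⟩

theorem exists_of_inl_eq_inr {x : P} {y : L} (h : inl i l x = inr i l y) :
    ∃ z, i z = x ∧ l z = y := by
  obtain ⟨z, hz⟩ := (Submodule.Quotient.eq _).1 h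
  exact ⟨z, by simpa using hz⟩

variable {i l}

/-- The map out of the pushout determined by compatible maps out of `P` and `L`. -/
def desc (s : P →ₗ[A] W) (t : L →ₗ[A] W) (h : s ∘ₗ i = t ∘ₗ l) : PushoutModule i l →ₗ[A] W :=
  (LinearMap.range (i.prod (-l))).liftQ (s.coprod t) <| by
    rintro _ ⟨z, rfl⟩
    simpa [sub_eq_zero, ← sub_eq_add_neg] using LinearMap.congr_fun h z

variable {s : P →ₗ[A] W} {t : L →ₗ[A] W} (h : s ∘ₗ i = t ∘ₗ l)

theorem desc_comp_inl : desc s t h ∘ₗ inl i l = s := by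
  ext x
  simp [desc, inl]

theorem desc_comp_inr : desc s t h ∘ₗ inr i l = t := by
  ext y
  simp [desc, inr]

theorem desc_inl (x : P) : desc s t h (inl i l x) = s x := LinearMap.congr_fun (desc_comp_inl h) x

theorem desc_inr (y : L) : desc s t h (inr i l y) = t y := LinearMap.congr_fun (desc_comp_inr h) y

theorem desc_surjective (ht : Function.Surjective t) : Function.Surjective (desc s t h) := by
  intro w
  obtain ⟨y, rfl⟩ := ht w
  exact ⟨inr i l y, desc_inr h y⟩

theorem inr_surjective (hi : Function.Surjective i) : Function.Surjective (inr i l) := fun e => by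
  obtain ⟨x, y, rfl⟩ := exists_inl_add_inr i l e
  obtain ⟨z, rfl⟩ := hi x
  refine ⟨l z + y, ?_⟩
  rw [map_add, ← LinearMap.comp_apply, ← inl_comp, LinearMap.comp_apply]

theorem desc_surjective_left (hs : Function.Surjective s) : Function.Surjective (desc s t h) := by
  intro w
  obtain ⟨x, rfl⟩ := hs w
  exact ⟨inl i l x, desc_inl h x⟩

variable (i) in
theorem inl_injective (hl : Function.Injective l) : Function.Injective (inl i l) := by
  refine (injective_iff_map_eq_zero _).2 fun x hx => ?_
  obtain ⟨z, rfl, hz⟩ := exists_of_inl_eq_inr i l (x := x) (y := 0) (by rw [map_zero, hx])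
  rw [hl (hz.trans (map_zero l).symm), map_zero]

variable (i) in
theorem exact_inl_desc {q : L →ₗ[A] W} (hlq : Function.Exact l q) :
    Function.Exact (inl i l)
      (desc 0 q ((LinearMap.zero_comp i).trans hlq.linearMap_comp_eq_zero.symm)) := fun e => by
  constructor
  · intro he
    obtain ⟨x, y, rfl⟩ := exists_inl_add_inr i l e
    rw [map_add, desc_inl, desc_inr, LinearMap.zero_apply, zero_add] at he
    obtain ⟨z, rfl⟩ := (hlq y).1 he
    refine ⟨x + i z, ?_⟩
    rw [map_add, ← LinearMap.comp_apply, inl_comp, LinearMap.comp_apply]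
  · rintro ⟨x, rfl⟩
    exact desc_inl _ x

variable (l) in
theorem exact_inr_desc {π : P →ₗ[A] W} (hiπ : Function.Exact i π) :
    Function.Exact (inr i l)
      (desc π 0 (hiπ.linearMap_comp_eq_zero.trans (LinearMap.zero_comp l).symm)) := fun e => by
  constructor
  · intro he
    obtain ⟨x, y, rfl⟩ := exists_inl_add_inr i l e
    rw [map_add, desc_inl, desc_inr, LinearMap.zero_apply, add_zero] at he
    obtain ⟨z, rfl⟩ := (hiπ x).1 he
    refine ⟨l z + y, ?_⟩
    rw [map_add, ← LinearMap.comp_apply, ← inl_comp, LinearMap.comp_apply]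
  · rintro ⟨y, rfl⟩
    exact desc_inr _ y

end PushoutModule

open PushoutModule in
theorem IsShortExact.pushout {i : K →ₗ[A] P} {π : P →ₗ[A] X} (h : IsShortExact i π)
    (l : K →ₗ[A] L) :
    IsShortExact (inr i l)
      (desc π 0 (h.exact.linearMap_comp_eq_zero.trans (LinearMap.zero_comp l).symm)) where
  injective := by
    refine (injective_iff_map_eq_zero _).2 fun y hy => ?_
    obtain ⟨z, hz, rfl⟩ := exists_of_inl_eq_inr i l (x := 0) (by rw [map_zero, hy])
    rw [h.injective (hz.trans (map_zero i).symm), map_zero]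
  exact := exact_inr_desc l h.exact
  surjective := desc_surjective_left _ h.surjective

end Pushout

variable {A : Type u} [Ring A]

section ExtOne

variable {X Y Z K E P : FGModuleCat.{u} A}

theorem IsShortExact.shortComplex_shortExact {i : X →ₗ[A] Y} {p : Y →ₗ[A] Z}
    (h : IsShortExact i p) :
    (ShortComplex.mk (C := ModuleCat.{u} A) (X₁ := X.obj) (X₂ := Y.obj) (X₃ := Z.obj)
      (ModuleCat.ofHom i) (ModuleCat.ofHom p)
      (ModuleCat.hom_ext h.exact.linearMap_comp_eq_zero)).ShortExact where
  exact := (ShortComplex.ShortExact.moduleCat_exact_iff_function_exact _).2 h.exact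
  mono_f := (ModuleCat.mono_iff_injective _).2 h.injective
  epi_g := (ModuleCat.epi_iff_surjective _).2 h.surjective

theorem ExtOneVanishes.exists_extend (hXY : ExtOneVanishes X Y) {i : K →ₗ[A] E} {p : E →ₗ[A] X}
    (h : IsShortExact i p) (f : K →ₗ[A] Y) : ∃ g : E →ₗ[A] Y, g ∘ₗ i = f := by
  obtain ⟨x, hx⟩ := Abelian.Ext.contravariant_sequence_exact₁ h.shortComplex_shortExact Y.obj
    (Abelian.Ext.mk₀ (ModuleCat.ofHom f)) (n₁ := 1) rfl (hXY.elim _ _)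
  obtain ⟨g, rfl⟩ := (Abelian.Ext.mk₀_bijective _ _).2 x
  rw [Abelian.Ext.mk₀_comp_mk₀] at hx
  exact ⟨g.hom, congrArg ModuleCat.Hom.hom ((Abelian.Ext.mk₀_bijective _ _).1 hx)⟩

theorem ExtOneVanishes.exists_lift (hXY : ExtOneVanishes X Y) {i : Y →ₗ[A] E} {p : E →ₗ[A] Z}
    (h : IsShortExact i p) (f : X →ₗ[A] Z) : ∃ g : X →ₗ[A] E, p ∘ₗ g = f := by
  obtain ⟨x, hx⟩ := Abelian.Ext.covariant_sequence_exact₃ X.obj h.shortComplex_shortExact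
    (Abelian.Ext.mk₀ (ModuleCat.ofHom f)) (n₁ := 1) rfl (hXY.elim _ _)
  obtain ⟨g, rfl⟩ := (Abelian.Ext.mk₀_bijective _ _).2 x
  rw [Abelian.Ext.mk₀_comp_mk₀] at hx
  exact ⟨g.hom, congrArg ModuleCat.Hom.hom ((Abelian.Ext.mk₀_bijective _ _).1 hx)⟩

theorem extOneVanishes_of_forall_exists_extend [Module.Projective A P] {i : K →ₗ[A] P}
    {π : P →ₗ[A] X} (h : IsShortExact i π)
    (hY : ∀ f : K →ₗ[A] Y, ∃ g : P →ₗ[A] Y, g ∘ₗ i = f) : ExtOneVanishes X Y := by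
  have : Projective P.obj := (IsProjective.iff_projective P).1 inferInstance
  refine subsingleton_of_forall_eq 0 fun x => ?_
  obtain ⟨y, rfl⟩ := Abelian.Ext.contravariant_sequence_exact₃ h.shortComplex_shortExact Y.obj x
    (Abelian.Ext.eq_zero_of_projective _) (n₀ := 0) rfl
  obtain ⟨f, rfl⟩ := (Abelian.Ext.mk₀_bijective _ _).2 y
  obtain ⟨g, hg⟩ := hY f.hom
  have hf : f = ModuleCat.ofHom i ≫ ModuleCat.ofHom g := ModuleCat.hom_ext hg.symm
  rw [hf, ← Abelian.Ext.mk₀_comp_mk₀]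
  exact h.shortComplex_shortExact.extClass_comp_assoc _

theorem hasProjectiveDimensionLE_one_of_isShortExact [Module.Projective A P]
    [Module.Projective A K] {i : K →ₗ[A] P} {π : P →ₗ[A] X} (h : IsShortExact i π) :
    HasProjectiveDimensionLE X.obj 1 := by
  have : Projective P.obj := (IsProjective.iff_projective P).1 inferInstance
  have : Projective K.obj := (IsProjective.iff_projective K).1 inferInstance
  exact h.shortComplex_shortExact.hasProjectiveDimensionLT_X₃ 1
    (inferInstanceAs (HasProjectiveDimensionLT K.obj 1))
    (inferInstanceAs (HasProjectiveDimensionLT P.obj 2))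

variable [IsNoetherianRing A]

theorem ExtOneVanishes.of_surjective (hX : HasProjectiveDimensionLE X.obj 1)
    (hXY : ExtOneVanishes X Y) {p : Y →ₗ[A] Z} (hp : Function.Surjective p) :
    ExtOneVanishes X Z := by
  have h := (isShortExact_subtype_ker hp).shortComplex_shortExact (Y := Y) (Z := Z)
    (X := FGModuleCat.of A (LinearMap.ker p))
  refine subsingleton_of_forall_eq 0 fun x => ?_
  obtain ⟨y, rfl⟩ := Abelian.Ext.covariant_sequence_exact₃ X.obj h x (n₁ := 2) rfl
    (Abelian.Ext.eq_zero_of_hasProjectiveDimensionLT _ 2 le_rfl)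
  have hy : y = 0 := hXY.elim _ _
  rw [hy, Abelian.Ext.zero_comp]

theorem exists_isShortExact_free (X : FGModuleCat.{u} A) :
    ∃ (n : ℕ) (K : FGModuleCat.{u} A) (i : K →ₗ[A] (Fin n → A)) (π : (Fin n → A) →ₗ[A] X),
      IsShortExact i π := by
  obtain ⟨n, π, hπ⟩ := Module.Finite.exists_fin' A X
  exact ⟨n, FGModuleCat.of A (LinearMap.ker π), (LinearMap.ker π).subtype, π,
    isShortExact_subtype_ker hπ⟩

theorem extOneVanishes_of_forall_exists_section
    (h : ∀ (E : FGModuleCat.{u} A) (i : Y →ₗ[A] E) (p : E →ₗ[A] X), IsShortExact i p →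
      ∃ s : X →ₗ[A] E, p ∘ₗ s = LinearMap.id) : ExtOneVanishes X Y := by
  obtain ⟨n, K, i, π, hiπ⟩ := exists_isShortExact_free X
  refine extOneVanishes_of_forall_exists_extend (P := FGModuleCat.of A (Fin n → A)) hiπ fun f => ?_
  obtain ⟨s, hs⟩ := h (FGModuleCat.of A (PushoutModule i f)) _ _ (hiπ.pushout f)
  obtain ⟨r, hr⟩ := (hiπ.pushout f).exists_retraction hs
  refine ⟨r ∘ₗ PushoutModule.inl i f, ?_⟩
  rw [LinearMap.comp_assoc, PushoutModule.inl_comp, ← LinearMap.comp_assoc, hr, LinearMap.id_comp]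

theorem ExtOneVanishes.congr_right {Y' : FGModuleCat.{u} A} (h : ExtOneVanishes X Y)
    (e : Y ≃ₗ[A] Y') : ExtOneVanishes X Y' :=
  extOneVanishes_of_forall_exists_section fun _ i _ hip =>
    h.exists_lift (i := i ∘ₗ e.toLinearMap)
      ⟨hip.injective.comp e.injective, (e.precomp_exact_iff_exact).2 hip.exact, hip.surjective⟩ _

theorem ExtOneVanishes.pi (h : ExtOneVanishes X Y) (n : ℕ) :
    ExtOneVanishes X (FGModuleCat.of A (Fin n → Y)) := by
  obtain ⟨m, K, i, π, hiπ⟩ := exists_isShortExact_free X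
  refine extOneVanishes_of_forall_exists_extend (P := FGModuleCat.of A (Fin m → A)) hiπ fun f => ?_
  choose g hg using fun j => h.exists_extend (E := FGModuleCat.of A (Fin m → A)) hiπ
    (LinearMap.proj j ∘ₗ f)
  exact ⟨LinearMap.pi g, LinearMap.ext fun x => funext fun j => LinearMap.congr_fun (hg j) x⟩

theorem ExtOneVanishes.prod (hX : ExtOneVanishes X Z) (hY : ExtOneVanishes Y Z) :
    ExtOneVanishes (FGModuleCat.of A (X × Y)) Z := by
  refine extOneVanishes_of_forall_exists_section fun E i p hip => ?_
  obtain ⟨s, hs⟩ := hX.exists_lift hip (LinearMap.inl A X Y)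
  obtain ⟨t, ht⟩ := hY.exists_lift hip (LinearMap.inr A X Y)
  refine ⟨s.coprod t, ?_⟩
  rw [LinearMap.comp_coprod, hs, ht]
  exact LinearMap.coprod_inl_inr

end ExtOne

/-! ### Additive closures and traces -/

section FactorsThrough

variable {T X Y Z : Type*} [AddCommGroup T] [Module A T] [AddCommGroup X] [Module A X]
  [AddCommGroup Y] [Module A Y] [AddCommGroup Z] [Module A Z]

/-- `f` factors through a finite direct sum of copies of `T`. The two factors are recorded by their
components, so that the maps with this property visibly form an ideal. -/
def FactorsThrough (T : Type*) [AddCommGroup T] [Module A T] (f : X →ₗ[A] Y) : Prop :=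
  ∃ (n : ℕ) (a : Fin n → X →ₗ[A] T) (b : Fin n → T →ₗ[A] Y), f = ∑ i, b i ∘ₗ a i

theorem factorsThrough_comp (a : X →ₗ[A] T) (b : T →ₗ[A] Y) : FactorsThrough T (b ∘ₗ a) :=
  ⟨1, fun _ => a, fun _ => b, by simp⟩

theorem factorsThrough_id_pi (n : ℕ) :
    FactorsThrough T (LinearMap.id : (Fin n → T) →ₗ[A] (Fin n → T)) :=
  ⟨n, LinearMap.proj, LinearMap.single A fun _ => T, by ext i x j; simp⟩

namespace FactorsThrough

theorem zero : FactorsThrough T (0 : X →ₗ[A] Y) :=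
  ⟨0, Fin.elim0, Fin.elim0, by simp⟩

theorem add {f g : X →ₗ[A] Y} (hf : FactorsThrough T f) (hg : FactorsThrough T g) :
    FactorsThrough T (f + g) := by
  obtain ⟨n, a, b, rfl⟩ := hf
  obtain ⟨m, c, d, rfl⟩ := hg
  exact ⟨n + m, Fin.append a c, Fin.append b d, by simp [Fin.sum_univ_add]⟩

theorem sum {ι : Type*} (s : Finset ι) {f : ι → X →ₗ[A] Y}
    (hf : ∀ i ∈ s, FactorsThrough T (f i)) : FactorsThrough T (∑ i ∈ s, f i) :=
  Finset.sum_induction f (FactorsThrough T) (fun _ _ => add) zero hf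

theorem comp_left {f : X →ₗ[A] Y} (hf : FactorsThrough T f) (g : Y →ₗ[A] Z) :
    FactorsThrough T (g ∘ₗ f) := by
  obtain ⟨n, a, b, rfl⟩ := hf
  exact ⟨n, a, fun i => g ∘ₗ b i, by ext; simp⟩

theorem comp_right {f : Y →ₗ[A] Z} (hf : FactorsThrough T f) (g : X →ₗ[A] Y) :
    FactorsThrough T (f ∘ₗ g) := by
  obtain ⟨n, a, b, rfl⟩ := hf
  exact ⟨n, fun i => a i ∘ₗ g, b, by ext; simp⟩

theorem comp_of_id (h : FactorsThrough T (LinearMap.id : Y →ₗ[A] Y)) (f : X →ₗ[A] Y)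
    (g : Y →ₗ[A] Z) : FactorsThrough T (g ∘ₗ f) :=
  (h.comp_right f).comp_left g

theorem trans {T' : Type*} [AddCommGroup T'] [Module A T'] {f : X →ₗ[A] Y}
    (hf : FactorsThrough T f) (h : FactorsThrough T' (LinearMap.id : T →ₗ[A] T)) :
    FactorsThrough T' f := by
  obtain ⟨n, a, b, rfl⟩ := hf
  exact FactorsThrough.sum _ fun i _ => h.comp_of_id (a i) (b i)

end FactorsThrough

end FactorsThrough

section AddClosure

variable {T T' X Y : FGModuleCat.{u} A}

theorem addClosure_iff_factorsThrough_id :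
    addClosure T X ↔ FactorsThrough T (LinearMap.id : X →ₗ[A] X) := by
  constructor
  · rintro ⟨n, i, r, h⟩
    rw [← h]
    exact (factorsThrough_id_pi n).comp_of_id i r
  · rintro ⟨n, a, b, h⟩
    refine ⟨n, LinearMap.pi a, ∑ i, b i ∘ₗ LinearMap.proj i, ?_⟩
    rw [h]
    ext
    simp

theorem addClosure.trans (h : addClosure T X) (h' : addClosure X Y) : addClosure T Y :=
  addClosure_iff_factorsThrough_id.2
    ((addClosure_iff_factorsThrough_id.1 h').trans (addClosure_iff_factorsThrough_id.1 h))

theorem addClosure_le (h : addClosure T' T) : addClosure T ≤ addClosure T' :=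
  fun _ hX => h.trans hX

theorem addClosure_of_isDirectSummand (h : IsDirectSummand (A := A) X T) : addClosure T X := by
  obtain ⟨i, r, h⟩ := h
  exact addClosure_iff_factorsThrough_id.2 (h ▸ factorsThrough_comp i r)

theorem addClosure_of_equiv (e : T ≃ₗ[A] X) : addClosure T X :=
  addClosure_of_isDirectSummand ⟨e.symm.toLinearMap, e.toLinearMap, e.comp_symm⟩

theorem addClosure_self : addClosure T T := addClosure_of_equiv (LinearEquiv.refl A T)

theorem addClosure_pi (n : ℕ) : addClosure T (FGModuleCat.of A (Fin n → T)) :=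
  addClosure_iff_factorsThrough_id.2 (factorsThrough_id_pi n)

theorem addClosure.prod (hX : addClosure T X) (hY : addClosure T Y) :
    addClosure T (FGModuleCat.of A (X × Y)) := by
  rw [addClosure_iff_factorsThrough_id] at hX hY ⊢
  convert (hX.comp_of_id (LinearMap.fst A X Y) (LinearMap.inl A X Y)).add
    (hY.comp_of_id (LinearMap.snd A X Y) (LinearMap.inr A X Y)) using 1
  ext <;> simp

theorem addClosure_prod_left : addClosure (FGModuleCat.of A (X × Y)) X :=
  addClosure_of_isDirectSummand
    ⟨LinearMap.inl A X Y, LinearMap.fst A X Y, LinearMap.fst_comp_inl A X Y⟩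

theorem addClosure_prod_right : addClosure (FGModuleCat.of A (X × Y)) Y :=
  addClosure_of_isDirectSummand
    ⟨LinearMap.inr A X Y, LinearMap.snd A X Y, LinearMap.snd_comp_inr A X Y⟩

theorem ExtOneVanishes.of_addClosure [IsNoetherianRing A] (hT : ExtOneVanishes T Y)
    (hX : addClosure T X) : ExtOneVanishes X Y := by
  refine extOneVanishes_of_forall_exists_section fun E i p hip => ?_
  obtain ⟨n, a, b, hab⟩ := addClosure_iff_factorsThrough_id.1 hX
  choose c hc using fun j => hT.exists_lift hip (b j)
  refine ⟨∑ j, c j ∘ₗ a j, ?_⟩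
  have hpc (j) (y : T) : p (c j y) = b j y := LinearMap.congr_fun (hc j) y
  rw [hab]
  ext x
  simp [hpc]

theorem extPerp_addClosure [IsNoetherianRing A] {𝒯 : ObjectProperty (FGModuleCat.{u} A)}
    (hX : extPerp 𝒯 X) (h : addClosure X Y) : extPerp 𝒯 Y :=
  fun Z hZ => (hX Z hZ).of_addClosure h

end AddClosure

section Trace

variable {T X Y : Type*} [AddCommGroup T] [Module A T] [AddCommGroup X] [Module A X]
  [AddCommGroup Y] [Module A Y]

variable (A T X) in
/-- The trace of `T` in `X`: the sum of the images of all maps `T → X`. It is the largest submodule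
of `X` generated by `T`. -/
def trace : Submodule A X := ⨆ f : T →ₗ[A] X, LinearMap.range f

theorem range_le_trace (f : T →ₗ[A] X) : LinearMap.range f ≤ trace A T X :=
  le_iSup (fun f : T →ₗ[A] X => LinearMap.range f) f

theorem apply_mem_trace (f : T →ₗ[A] X) (t : T) : f t ∈ trace A T X :=
  range_le_trace f (LinearMap.mem_range_self f t)

theorem map_trace_le (g : X →ₗ[A] Y) : (trace A T X).map g ≤ trace A T Y := by
  rw [trace, Submodule.map_iSup]
  refine iSup_le fun f => ?_
  rw [← LinearMap.range_comp]
  exact range_le_trace _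

theorem trace_trace : trace A T (trace A T X) = ⊤ := by
  have h : trace A T X ≤ (trace A T (trace A T X)).map (trace A T X).subtype := by
    refine iSup_le fun f => ?_
    rintro _ ⟨t, rfl⟩
    exact ⟨_, apply_mem_trace (f.codRestrict (trace A T X) (apply_mem_trace f)) t, rfl⟩
  refine eq_top_iff.2 fun x _ => ?_
  obtain ⟨y, hy, hyx⟩ := h x.2
  rwa [← Subtype.ext hyx]

theorem trace_le_ker_of_forall_eq_zero (hY : ∀ f : T →ₗ[A] Y, f = 0) (f : X →ₗ[A] Y) :
    trace A T X ≤ LinearMap.ker f :=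
  iSup_le fun g => LinearMap.range_le_ker_iff.2 (hY (f ∘ₗ g))

end Trace

section Gen

variable {T T' X Y : FGModuleCat.{u} A}

theorem trace_eq_top_of_gen (h : Gen T X) : trace A T X = ⊤ := by
  obtain ⟨n, f, hf⟩ := h
  refine eq_top_iff.2 fun y _ => ?_
  obtain ⟨x, rfl⟩ := hf y
  rw [← LinearMap.sum_single_apply (fun _ : Fin n => (T : Type u)) x, map_sum]
  exact Submodule.sum_mem _ fun i _ => apply_mem_trace (f ∘ₗ LinearMap.single A _ i) (x i)

theorem gen_of_trace_eq_top (h : trace A T X = ⊤) : Gen T X := by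
  classical
  have hX : IsCompactElement (⊤ : Submodule A X) :=
    (Submodule.fg_iff_compact _).1 Module.Finite.fg_top
  obtain ⟨s, hs⟩ := CompleteLattice.IsCompactElement.exists_finset_of_le_iSup _ hX
    (fun f : T →ₗ[A] X => LinearMap.range f) h.ge
  let F : (Fin s.card → T) →ₗ[A] X :=
    ∑ i, (s.equivFin.symm i : T →ₗ[A] X) ∘ₗ LinearMap.proj i
  have hF (f : T →ₗ[A] X) (hf : f ∈ s) (t : T) : F (Pi.single (s.equivFin ⟨f, hf⟩) t) = f t := by
    rw [LinearMap.sum_apply, Finset.sum_eq_single (s.equivFin ⟨f, hf⟩)]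
    · simp
    · intro i _ hi
      simp [Pi.single_eq_of_ne hi]
    · simp
  refine ⟨s.card, F, LinearMap.range_eq_top.1 (top_le_iff.1 (hs.trans (iSup₂_le fun f hf => ?_)))⟩
  rintro _ ⟨t, rfl⟩
  exact ⟨_, hF f hf t⟩

theorem gen_iff_trace_eq_top : Gen T X ↔ trace A T X = ⊤ :=
  ⟨trace_eq_top_of_gen, gen_of_trace_eq_top⟩

theorem gen_trace [IsNoetherianRing A] (T X : FGModuleCat.{u} A) :
    Gen T (FGModuleCat.of A (trace A T X)) :=
  gen_of_trace_eq_top trace_trace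

theorem Gen.of_surjective (h : Gen T X) {f : X →ₗ[A] Y} (hf : Function.Surjective f) :
    Gen T Y := by
  obtain ⟨n, g, hg⟩ := h
  exact ⟨n, f ∘ₗ g, hf.comp hg⟩

theorem gen_of_addClosure (h : addClosure T X) : Gen T X := by
  obtain ⟨n, i, r, h⟩ := h
  exact ⟨n, r, fun x => ⟨i x, LinearMap.congr_fun h x⟩⟩

theorem gen_self : Gen T T := gen_of_addClosure addClosure_self

theorem Gen.trans (h : Gen T' T) (hX : Gen T X) : Gen T' X := by
  rw [gen_iff_trace_eq_top] at *
  rw [eq_top_iff, ← hX]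
  refine iSup_le fun f => ?_
  rw [LinearMap.range_eq_map, ← h]
  exact map_trace_le f

theorem Gen.eq_zero (hX : Gen T X) (hY : homPerp T Y) (f : X →ₗ[A] Y) : f = 0 :=
  LinearMap.ker_eq_top.1
    (top_le_iff.1 (trace_eq_top_of_gen hX ▸ trace_le_ker_of_forall_eq_zero hY f))

theorem homPerp_quotient_trace [IsNoetherianRing A] (X : FGModuleCat.{u} A)
    (hT : ExtOneVanishes T (FGModuleCat.of A (trace A T X))) :
    homPerp T (FGModuleCat.of A (X ⧸ trace A T X)) := by
  intro f
  obtain ⟨g, rfl⟩ := hT.exists_lift (E := X) (Z := FGModuleCat.of A (X ⧸ trace A T X))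
    (isShortExact_subtype_mkQ _) f
  exact LinearMap.ext fun t => (Submodule.Quotient.mk_eq_zero _).2 (apply_mem_trace g t)

theorem gen_of_forall_eq_zero [IsNoetherianRing A]
    (hT : ExtOneVanishes T (FGModuleCat.of A (trace A T X)))
    (h : ∀ Y, Gen X Y → homPerp T Y → ∀ f : X →ₗ[A] Y, f = 0) : Gen T X := by
  have h0 : (trace A T X).mkQ = 0 := h (FGModuleCat.of A (X ⧸ trace A T X))
    (gen_self.of_surjective (Submodule.mkQ_surjective _)) (homPerp_quotient_trace X hT) _
  rw [gen_iff_trace_eq_top, ← Submodule.ker_mkQ (trace A T X), h0, LinearMap.ker_zero]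

theorem isTorsionPair_gen [IsNoetherianRing A] (hT : extPerp (Gen T) T) :
    IsTorsionPair (Gen T) (homPerp T) where
  torsion_iff X :=
    ⟨fun hX _ hY f => hX.eq_zero hY f, fun h =>
      gen_of_forall_eq_zero (hT _ (gen_trace T X)) fun Y _ => h Y⟩
  torsionFree_iff _ :=
    ⟨fun hY _ hX f => hX.eq_zero hY f, fun h => h T gen_self⟩

end Gen

/-! ### Torsion classes and approximation sequences -/

section TorsionClass

/-- Torsion classes, described by their closure properties instead of by a torsion pair. -/
structure IsTorsionClass (𝒯 : ObjectProperty (FGModuleCat.{u} A)) : Prop where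
  of_surjective : ∀ {X Y : FGModuleCat.{u} A} {f : X →ₗ[A] Y}, 𝒯 X → Function.Surjective f → 𝒯 Y
  of_isShortExact : ∀ {X E Z : FGModuleCat.{u} A} {i : X →ₗ[A] E} {p : E →ₗ[A] Z},
    IsShortExact i p → 𝒯 X → 𝒯 Z → 𝒯 E

theorem IsTorsionPair.isTorsionClass {𝒯 ℱ : ObjectProperty (FGModuleCat.{u} A)}
    (h : IsTorsionPair 𝒯 ℱ) : IsTorsionClass 𝒯 where
  of_surjective {X Y f} hX hf := by
    rw [h.torsion_iff] at *
    intro W hW g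
    exact (LinearMap.cancel_right hf).1 (hX W hW (g ∘ₗ f))
  of_isShortExact {X E Z i p} hip hX hZ := by
    rw [h.torsion_iff] at *
    intro W hW g
    obtain ⟨u, rfl⟩ := exists_comp_eq_of_exact hip.exact hip.surjective g (hX W hW _)
    rw [hZ W hW u, LinearMap.zero_comp]

theorem isTorsionClass_gen [IsNoetherianRing A] {T : FGModuleCat.{u} A}
    (hT : extPerp (Gen T) T) : IsTorsionClass (Gen T) :=
  (isTorsionPair_gen hT).isTorsionClass

namespace IsTorsionClass

variable {𝒯 : ObjectProperty (FGModuleCat.{u} A)} (h𝒯 : IsTorsionClass 𝒯)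
  {X Y Z : FGModuleCat.{u} A}

include h𝒯

theorem prod (hX : 𝒯 X) (hY : 𝒯 Y) : 𝒯 (FGModuleCat.of A (X × Y)) :=
  h𝒯.of_isShortExact (X := X) (E := FGModuleCat.of A (X × Y)) (Z := Y) isShortExact_inl_snd hX hY

theorem pi (hX : 𝒯 X) (n : ℕ) : 𝒯 (FGModuleCat.of A (Fin n → X)) := by
  induction n with
  | zero =>
    exact h𝒯.of_surjective (X := X) (Y := FGModuleCat.of A (Fin 0 → X)) (f := 0) hX
      (Function.surjective_to_subsingleton _)
  | succ n ih =>
    exact h𝒯.of_surjective (X := FGModuleCat.of A (X × (Fin n → X)))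
      (Y := FGModuleCat.of A (Fin (n + 1) → X)) (h𝒯.prod (Y := FGModuleCat.of A (Fin n → X)) hX ih)
      (Fin.consLinearEquiv A fun _ => (X : Type u)).surjective

theorem gen_le (hX : 𝒯 X) : Gen X ≤ 𝒯 := by
  rintro Y ⟨n, f, hf⟩
  exact h𝒯.of_surjective (h𝒯.pi hX n) hf

theorem of_isDirectSummand (hY : 𝒯 Y) (h : IsDirectSummand (A := A) X Y) : 𝒯 X :=
  h𝒯.gen_le hY _ (gen_of_addClosure (addClosure_of_isDirectSummand h))

theorem comap_range [IsNoetherianRing A] {E W L : FGModuleCat.{u} A} {i : Z →ₗ[A] W}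
    {q : W →ₗ[A] E} (hiq : IsShortExact i q) (hZ : 𝒯 Z) (hL : 𝒯 L) (j : L →ₗ[A] E) :
    𝒯 (FGModuleCat.of A ((LinearMap.range j).comap q)) := by
  let R := LinearMap.range j
  have hi (z : Z) : i z ∈ R.comap q := by
    rw [Submodule.mem_comap, hiq.exact.apply_apply_eq_zero]
    exact R.zero_mem
  have hR : 𝒯 (FGModuleCat.of A R) :=
    h𝒯.of_surjective (Y := FGModuleCat.of A R) hL j.surjective_rangeRestrict
  have hex : IsShortExact (i.codRestrict (R.comap q) hi)
      (q.restrict fun _ hx => hx : R.comap q →ₗ[A] R) := by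
    refine ⟨hiq.injective.codRestrict hi, fun w => ⟨fun hw => ?_, ?_⟩, ?_⟩
    · obtain ⟨z, hz⟩ := (hiq.exact w.1).1 (congrArg Subtype.val hw)
      exact ⟨z, Subtype.ext hz⟩
    · rintro ⟨z, rfl⟩
      exact Subtype.ext (hiq.exact.apply_apply_eq_zero z)
    · rintro ⟨e, he⟩
      obtain ⟨w, rfl⟩ := hiq.surjective e
      exact ⟨⟨w, he⟩, rfl⟩
  exact h𝒯.of_isShortExact (E := FGModuleCat.of A (R.comap q)) (Z := FGModuleCat.of A R) hex hZ hR

end IsTorsionClass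

end TorsionClass

section ApproxSequence

/-- An exact sequence `M → Y → X → 0` in which `M → Y` is a left `𝒯`-approximation and
`Ext¹(X, 𝒯) = 0`, as provided by a left weak cotorsion pair. -/
structure IsApproxSequence (𝒯 : ObjectProperty (FGModuleCat.{u} A)) {M : Type u} [AddCommGroup M]
    [Module A M] {Y X : FGModuleCat.{u} A} (g : M →ₗ[A] Y) (p : Y →ₗ[A] X) : Prop where
  exact : Function.Exact g p
  surjective : Function.Surjective p
  mem : 𝒯 Y
  ext : extPerp 𝒯 X
  approx : ∀ Z, 𝒯 Z → ∀ h : M →ₗ[A] Z, ∃ h' : Y →ₗ[A] Z, h' ∘ₗ g = h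

namespace IsApproxSequence

variable {𝒯 : ObjectProperty (FGModuleCat.{u} A)} {M P N : Type u} [AddCommGroup M] [Module A M]
  [AddCommGroup P] [Module A P] [AddCommGroup N] [Module A N] {Y X : FGModuleCat.{u} A}
  {g : M →ₗ[A] Y} {p : Y →ₗ[A] X}

theorem mem_right (hs : IsApproxSequence 𝒯 g p) (h𝒯 : IsTorsionClass 𝒯) : 𝒯 X :=
  h𝒯.of_surjective hs.mem hs.surjective

theorem pushout (hs : IsApproxSequence 𝒯 g p) (h𝒯 : IsTorsionClass 𝒯) {π : M →ₗ[A] N}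
    (hπ : Function.Surjective π) [Module.Finite A N] :
    IsApproxSequence 𝒯 (Y := FGModuleCat.of A (PushoutModule π g)) (PushoutModule.inl π g)
      (PushoutModule.desc 0 p
        ((LinearMap.zero_comp π).trans hs.exact.linearMap_comp_eq_zero.symm)) where
  exact := PushoutModule.exact_inl_desc π hs.exact
  surjective := PushoutModule.desc_surjective _ hs.surjective
  mem := h𝒯.of_surjective (Y := FGModuleCat.of A (PushoutModule π g)) (f := PushoutModule.inr π g)
    hs.mem (PushoutModule.inr_surjective hπ)
  ext := hs.ext
  approx Z hZ h := by
    obtain ⟨t, ht⟩ := hs.approx Z hZ (h ∘ₗ π)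
    exact ⟨PushoutModule.desc h t ht.symm, PushoutModule.desc_comp_inl _⟩

theorem isDirectSummand_pushout {K : Type u} [AddCommGroup K] [Module A K]
    {L W : FGModuleCat.{u} A} {g : P →ₗ[A] Y} {p : Y →ₗ[A] X} {l : K →ₗ[A] L} {q : L →ₗ[A] W}
    (hg : IsApproxSequence 𝒯 g p) (hl : IsApproxSequence 𝒯 l q) {i : K →ₗ[A] P}
    [Module.Finite A P] (hE : 𝒯 (FGModuleCat.of A (PushoutModule i l))) :
    IsDirectSummand (A := A) (PushoutModule i l) (Y × W) := by
  obtain ⟨b, hb⟩ := hg.approx _ hE (PushoutModule.inl i l)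
  obtain ⟨t, ht⟩ := hl.approx Y hg.mem (g ∘ₗ i)
  let c : PushoutModule i l →ₗ[A] Y := PushoutModule.desc g t ht.symm
  have hc : c ∘ₗ PushoutModule.inl i l = g := PushoutModule.desc_comp_inl _
  obtain ⟨z, hz, hz'⟩ : ∃ z : PushoutModule i l →ₗ[A] W,
      Function.Exact (PushoutModule.inl i l) z ∧ Function.Surjective z :=
    ⟨_, PushoutModule.exact_inl_desc i hl.exact, PushoutModule.desc_surjective _ hl.surjective⟩
  obtain ⟨u, hu⟩ := exists_comp_eq_of_exact hz hz' (LinearMap.id - b ∘ₗ c) (by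
    rw [LinearMap.sub_comp, LinearMap.comp_assoc, hc, hb, LinearMap.id_comp, sub_self])
  refine ⟨c.prod z, b.coprod u, ?_⟩
  rw [LinearMap.coprod_comp_prod, hu]
  abel

variable [IsNoetherianRing A]

theorem congr (hs : IsApproxSequence 𝒯 g p) (h𝒯 : IsTorsionClass 𝒯) {Y' X' : FGModuleCat.{u} A}
    (eY : Y ≃ₗ[A] Y') (eX : X ≃ₗ[A] X') :
    IsApproxSequence 𝒯 (eY.toLinearMap ∘ₗ g) (eX.toLinearMap ∘ₗ p ∘ₗ eY.symm.toLinearMap) where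
  exact := hs.exact.of_ladder_linearEquiv_of_exact (e₁ := LinearEquiv.refl A M) (e₂ := eY)
    (e₃ := eX) rfl (by ext; simp)
  surjective := eX.surjective.comp (hs.surjective.comp eY.symm.surjective)
  mem := h𝒯.of_surjective hs.mem eY.surjective
  ext := extPerp_addClosure hs.ext (addClosure_of_equiv eX)
  approx Z hZ h := by
    obtain ⟨c, rfl⟩ := hs.approx Z hZ h
    exact ⟨c ∘ₗ eY.symm.toLinearMap, by ext; simp⟩

theorem pi (hs : IsApproxSequence 𝒯 g p) (h𝒯 : IsTorsionClass 𝒯) (n : ℕ) :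
    IsApproxSequence 𝒯 (Y := FGModuleCat.of A (Fin n → Y)) (X := FGModuleCat.of A (Fin n → X))
      (g.compLeft (Fin n)) (p.compLeft (Fin n)) where
  exact := exact_compLeft hs.exact n
  surjective := hs.surjective.comp_left
  mem := h𝒯.pi hs.mem n
  ext := extPerp_addClosure hs.ext (addClosure_pi n)
  approx Z hZ h := by
    choose t ht using fun i => hs.approx Z hZ (h ∘ₗ LinearMap.single A (fun _ => M) i)
    refine ⟨LinearMap.lsum A (fun _ => Y) ℕ t, LinearMap.pi_ext' fun i => ?_⟩
    rw [← ht i]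
    ext m
    simp [Pi.single_apply, apply_ite g, apply_ite (t _)]

theorem exists_of_finite {g : A →ₗ[A] Y} (hs : IsApproxSequence 𝒯 g p) (h𝒯 : IsTorsionClass 𝒯)
    (N : Type u) [AddCommGroup N] [Module A N] [Module.Finite A N] :
    ∃ (n : ℕ) (L : FGModuleCat.{u} A) (l : N →ₗ[A] L) (q : L →ₗ[A] (Fin n → X)),
      IsApproxSequence 𝒯 (X := FGModuleCat.of A (Fin n → X)) l q ∧
        (Function.Injective g → Function.Injective l) := by
  obtain ⟨n, π, hπ⟩ := Module.Finite.exists_fin' A N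
  exact ⟨n, _, _, _, (hs.pi h𝒯 n).pushout h𝒯 hπ,
    fun hg => PushoutModule.inl_injective π hg.comp_left⟩

theorem extPerp_pushout (hs : IsApproxSequence 𝒯 g p) (h𝒯 : IsTorsionClass 𝒯)
    [Module.Projective A P] [Module.Finite A P] (i : M →ₗ[A] P) :
    extPerp 𝒯 (FGModuleCat.of A (PushoutModule i g)) := by
  refine fun Z hZ => extOneVanishes_of_forall_exists_section fun W i' q hiq => ?_
  obtain ⟨s, hs'⟩ := Module.projective_lifting_property q (PushoutModule.inl i g) hiq.surjective
  let D : Submodule A W := (LinearMap.range (PushoutModule.inr i g)).comap q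
  have hD : 𝒯 (FGModuleCat.of A D) := h𝒯.comap_range hiq hZ hs.mem _
  have hsD (m : M) : s (i m) ∈ D :=
    ⟨g m, ((LinearMap.congr_fun hs' (i m)).trans
      (LinearMap.congr_fun (PushoutModule.inl_comp i g) m)).symm⟩
  obtain ⟨t, ht⟩ := hs.approx _ hD ((s ∘ₗ i).codRestrict D hsD)
  have hst : s ∘ₗ i = (D.subtype ∘ₗ t) ∘ₗ g := by
    rw [LinearMap.comp_assoc, ht]
    rfl
  let r : PushoutModule i g →ₗ[A] W := PushoutModule.desc s (D.subtype ∘ₗ t) hst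
  obtain ⟨z, hz, hz'⟩ : ∃ z : PushoutModule i g →ₗ[A] X,
      Function.Exact (PushoutModule.inl i g) z ∧ Function.Surjective z :=
    ⟨_, PushoutModule.exact_inl_desc i hs.exact, PushoutModule.desc_surjective _ hs.surjective⟩
  obtain ⟨u, hu⟩ := exists_comp_eq_of_exact hz hz' (LinearMap.id - q ∘ₗ r) (by
    rw [LinearMap.sub_comp, LinearMap.comp_assoc, PushoutModule.desc_comp_inl, hs',
      LinearMap.id_comp, sub_self])
  obtain ⟨u', rfl⟩ := (hs.ext Z hZ).exists_lift hiq u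
  refine ⟨r + u' ∘ₗ z, ?_⟩
  rw [LinearMap.comp_add, ← LinearMap.comp_assoc, hu]
  abel

theorem extPerp_middle [Module.Projective A M] [Module.Finite A M] (hs : IsApproxSequence 𝒯 g p)
    (h𝒯 : IsTorsionClass 𝒯) : extPerp 𝒯 Y :=
  extPerp_addClosure (hs.extPerp_pushout h𝒯 LinearMap.id) (addClosure_of_isDirectSummand
    ⟨PushoutModule.inr _ g, PushoutModule.desc g LinearMap.id rfl, PushoutModule.desc_comp_inr _⟩)

variable {g : A →ₗ[A] Y}

theorem inf_le_addClosure_prod (hs : IsApproxSequence 𝒯 g p) (h𝒯 : IsTorsionClass 𝒯) :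
    extPerp 𝒯 ⊓ 𝒯 ≤ addClosure (FGModuleCat.of A (Y × X)) := by
  rintro Z ⟨hZ, hZ'⟩
  obtain ⟨n, K, i, π, hiπ⟩ := exists_isShortExact_free Z
  obtain ⟨m, L, l, q, hl, -⟩ := hs.exists_of_finite h𝒯 K
  let E := FGModuleCat.of A (PushoutModule i l)
  have hE : 𝒯 E := h𝒯.of_isShortExact (E := E) (hiπ.pushout l) hl.mem hZ'
  have hEYX : addClosure (FGModuleCat.of A (Y × X)) E :=
    ((addClosure_prod_left.trans (addClosure_pi n)).prod
      (addClosure_prod_right.trans (addClosure_pi m))).trans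
      (addClosure_of_isDirectSummand ((hs.pi h𝒯 n).isDirectSummand_pushout hl hE))
  obtain ⟨s, hs'⟩ := (hZ L hl.mem).exists_lift (E := E) (hiπ.pushout l) LinearMap.id
  exact hEYX.trans (addClosure_of_isDirectSummand ⟨s, _, hs'⟩)

theorem addClosure_prod_eq (hs : IsApproxSequence 𝒯 g p) (h𝒯 : IsTorsionClass 𝒯) :
    addClosure (FGModuleCat.of A (Y × X)) = extPerp 𝒯 ⊓ 𝒯 := by
  refine le_antisymm (fun Z hZ => ⟨extPerp_addClosure (fun W hW => ?_) hZ, ?_⟩)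
    (hs.inf_le_addClosure_prod h𝒯)
  · exact ExtOneVanishes.prod (hs.extPerp_middle h𝒯 W hW) (hs.ext W hW)
  · exact h𝒯.gen_le (h𝒯.prod hs.mem (hs.mem_right h𝒯)) _ (gen_of_addClosure hZ)

theorem gen_eq (hs : IsApproxSequence 𝒯 g p) (h𝒯 : IsTorsionClass 𝒯) {T : FGModuleCat.{u} A}
    (hT : addClosure T = extPerp 𝒯 ⊓ 𝒯) : Gen T = 𝒯 := by
  have hTT : (extPerp 𝒯 ⊓ 𝒯) T := hT ▸ addClosure_self
  have hTY : addClosure T Y := hT ▸ ⟨hs.extPerp_middle h𝒯, hs.mem⟩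
  refine le_antisymm (h𝒯.gen_le hTT.2) fun Z hZ => ?_
  obtain ⟨n, π, hπ⟩ := Module.Finite.exists_fin' A Z
  obtain ⟨h, rfl⟩ := (hs.pi h𝒯 n).approx Z hZ π
  exact (gen_of_addClosure hTY).trans
    ⟨n, h, Function.Surjective.of_comp (g := g.compLeft (Fin n)) hπ⟩

end IsApproxSequence

end ApproxSequence

/-! ### Silting modules, tilting modules and cotorsion-torsion triples -/

section Silting

/-- (Finitely generated) silting modules: `Ext¹(T, Gen T) = 0` and `A` has a left
`Gen T`-approximation in `add T` with cokernel in `add T`. Over finite dimensional algebras these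
are the support τ-tilting modules, but the definition makes no reference to `τ`. -/
structure IsSilting (T : FGModuleCat.{u} A) : Prop where
  ext : extPerp (Gen T) T
  exists_approxSequence : ∃ (Y X : FGModuleCat.{u} A) (g : A →ₗ[A] Y) (p : Y →ₗ[A] X),
    addClosure T Y ∧ addClosure T X ∧ IsApproxSequence (Gen T) g p

variable {𝒞 𝒯 𝒳 : ObjectProperty (FGModuleCat.{u} A)}

theorem isStableUnderRetracts_iff :
    𝒳.IsStableUnderRetracts ↔
      ∀ X Y : FGModuleCat.{u} A, IsDirectSummand (A := A) X Y → 𝒳 Y → 𝒳 X := by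
  constructor
  · rintro h X Y ⟨i, r, hir⟩ hY
    exact h.of_retract ⟨FGModuleCat.ofHom i, FGModuleCat.ofHom r, FGModuleCat.hom_ext hir⟩ hY
  · intro h
    refine ⟨fun {X Y} r hY => h X Y ⟨r.i.hom.hom, r.r.hom.hom, ?_⟩ hY⟩
    rw [← FGModuleCat.hom_hom_comp, r.retract]
    rfl

theorem IsLeftWeakCotorsionPair.eq_extPerp (h : IsLeftWeakCotorsionPair 𝒞 𝒯) : 𝒞 = extPerp 𝒯 := by
  refine le_antisymm (fun X hX Y hY => h.ext_vanishes X Y hX hY) fun M hM => ?_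
  obtain ⟨X, Y, i, f, hX, hY, hi, hif, hf, -⟩ := h.right_sequence M
  obtain ⟨s, hs⟩ := (hM Y hY).exists_lift ⟨hi, hif, hf⟩ LinearMap.id
  exact isStableUnderRetracts_iff.1 h.summands_left M X ⟨s, f, hs⟩ hX

theorem IsLeftSequence.exists_isApproxSequence {M Y : FGModuleCat.{u} A} {g : M →ₗ[A] Y}
    (hg : IsLeftSequence 𝒞 𝒯 g) (h : 𝒞 ≤ extPerp 𝒯) :
    ∃ (X : FGModuleCat.{u} A) (p : Y →ₗ[A] X), IsApproxSequence 𝒯 g p := by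
  obtain ⟨X, p, hX, hY, hgp, hp, -, happ⟩ := hg
  exact ⟨X, p, hgp, hp, hY, h X hX, happ⟩

theorem IsApproxSequence.isLeftSequence {M Y X : FGModuleCat.{u} A} {g : M →ₗ[A] Y}
    {p : Y →ₗ[A] X} (hs : IsApproxSequence 𝒯 g p) : IsLeftSequence (extPerp 𝒯) 𝒯 g :=
  ⟨X, p, hs.ext, hs.mem, hs.exact, hs.surjective, hs.mem, hs.approx⟩

theorem IsLwCotorsionTorsion.exists_isApproxSequence {t : SubcatTriple A}
    (ht : IsLwCotorsionTorsion t) :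
    ∃ (Y X : FGModuleCat.{u} A) (g : A →ₗ[A] Y) (p : Y →ₗ[A] X), IsApproxSequence t.T g p := by
  obtain ⟨Y, g, hg⟩ := ht.1.left_sequence (FGModuleCat.of A A)
  obtain ⟨X, p, hs⟩ := hg.exists_isApproxSequence ht.1.eq_extPerp.le
  exact ⟨Y, X, g, p, hs⟩

variable [IsNoetherianRing A]

theorem IsSilting.addClosure_eq {T : FGModuleCat.{u} A} (hT : IsSilting T) :
    addClosure T = extPerp (Gen T) ⊓ Gen T := by
  obtain ⟨Y, X, g, p, hY, hX, hs⟩ := hT.exists_approxSequence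
  refine le_antisymm (fun Z hZ => ⟨extPerp_addClosure hT.ext hZ, gen_of_addClosure hZ⟩) ?_
  exact (hs.inf_le_addClosure_prod (isTorsionClass_gen hT.ext)).trans (addClosure_le (hY.prod hX))

namespace IsApproxSequence

variable {Y X : FGModuleCat.{u} A} {g : A →ₗ[A] Y} {p : Y →ₗ[A] X}

theorem isSilting (hs : IsApproxSequence 𝒯 g p) (h𝒯 : IsTorsionClass 𝒯) {T : FGModuleCat.{u} A}
    (hT : addClosure T = extPerp 𝒯 ⊓ 𝒯) : IsSilting T := by
  have hTT : (extPerp 𝒯 ⊓ 𝒯) T := hT ▸ addClosure_self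
  have hGen := hs.gen_eq h𝒯 hT
  refine ⟨hGen ▸ hTT.1, Y, X, g, p, ?_, ?_, hGen ▸ hs⟩
  · exact hT ▸ ⟨hs.extPerp_middle h𝒯, hs.mem⟩
  · exact hT ▸ ⟨hs.ext, hs.mem_right h𝒯⟩

theorem hasRightSequence (hs : IsApproxSequence 𝒯 g p) (h𝒯 : IsTorsionClass 𝒯)
    (M : FGModuleCat.{u} A) : HasRightSequence (extPerp 𝒯) 𝒯 M := by
  obtain ⟨n, K, i, π, hiπ⟩ := exists_isShortExact_free M
  obtain ⟨m, L, l, q, hl, -⟩ := hs.exists_of_finite h𝒯 K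
  let E := FGModuleCat.of A (PushoutModule i l)
  have hLEM := hiπ.pushout l
  have hE : extPerp 𝒯 E := hl.extPerp_pushout h𝒯 i
  exact ⟨E, L, _, _, hE, hl.mem, hLEM.injective, hLEM.exact, hLEM.surjective, hE,
    fun X' hX' h => (hX' L hl.mem).exists_lift (E := E) hLEM h⟩

theorem exists_isLeftSequence (hs : IsApproxSequence 𝒯 g p) (h𝒯 : IsTorsionClass 𝒯)
    (M : FGModuleCat.{u} A) :
    ∃ (L : FGModuleCat.{u} A) (l : M →ₗ[A] L), IsLeftSequence (extPerp 𝒯) 𝒯 l ∧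
      (Function.Injective g → Function.Injective l) := by
  obtain ⟨n, L, l, q, hl, hinj⟩ := hs.exists_of_finite h𝒯 M
  exact ⟨L, l, hl.isLeftSequence, hinj⟩

theorem isLeftWeakCotorsionPair (hs : IsApproxSequence 𝒯 g p) (h𝒯 : IsTorsionClass 𝒯) :
    IsLeftWeakCotorsionPair (extPerp 𝒯) 𝒯 where
  summands_left := isStableUnderRetracts_iff.2 fun _ _ h hY =>
    extPerp_addClosure hY (addClosure_of_isDirectSummand h)
  summands_right := isStableUnderRetracts_iff.2 fun _ _ h hY => h𝒯.of_isDirectSummand hY h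
  ext_vanishes _ Y hX hY := hX Y hY
  right_sequence := hs.hasRightSequence h𝒯
  left_sequence M := by
    obtain ⟨L, l, hl, -⟩ := hs.exists_isLeftSequence h𝒯 M
    exact ⟨L, l, hl⟩

theorem isCotorsionPair (hs : IsApproxSequence 𝒯 g p) (h𝒯 : IsTorsionClass 𝒯)
    (hg : Function.Injective g) : IsCotorsionPair (extPerp 𝒯) 𝒯 where
  toIsLeftWeakCotorsionPair := hs.isLeftWeakCotorsionPair h𝒯
  left_sequence_injective M := by
    obtain ⟨L, l, hl, hinj⟩ := hs.exists_isLeftSequence h𝒯 M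
    exact ⟨L, l, hl, hinj hg⟩

end IsApproxSequence

theorem IsSilting.isLwCotorsionTorsion {T : FGModuleCat.{u} A} (hT : IsSilting T) :
    IsLwCotorsionTorsion (tripleOf T) := by
  obtain ⟨Y, X, g, p, -, -, hs⟩ := hT.exists_approxSequence
  exact ⟨hs.isLeftWeakCotorsionPair (isTorsionClass_gen hT.ext), isTorsionPair_gen hT.ext⟩

namespace IsLwCotorsionTorsion

variable {t : SubcatTriple A}

theorem exists_addClosure_eq (ht : IsLwCotorsionTorsion t) :
    ∃ T : FGModuleCat.{u} A, addClosure T = t.C ⊓ t.T := by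
  obtain ⟨Y, X, g, p, hs⟩ := ht.exists_isApproxSequence
  exact ⟨_, by rw [hs.addClosure_prod_eq ht.2.isTorsionClass, ht.1.eq_extPerp]⟩

theorem isSilting (ht : IsLwCotorsionTorsion t) {T : FGModuleCat.{u} A}
    (hT : addClosure T = t.C ⊓ t.T) : IsSilting T := by
  obtain ⟨Y, X, g, p, hs⟩ := ht.exists_isApproxSequence
  exact hs.isSilting ht.2.isTorsionClass (ht.1.eq_extPerp ▸ hT)

theorem tripleOf_eq (ht : IsLwCotorsionTorsion t) {T : FGModuleCat.{u} A}
    (hT : addClosure T = t.C ⊓ t.T) : tripleOf T = t := by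
  obtain ⟨Y, X, g, p, hs⟩ := ht.exists_isApproxSequence
  have hGen : Gen T = t.T := hs.gen_eq ht.2.isTorsionClass (ht.1.eq_extPerp ▸ hT)
  refine SubcatTriple.ext ?_ hGen (funext fun Z => propext ?_)
  · rw [ht.1.eq_extPerp, ← hGen]
    rfl
  · rw [ht.2.torsionFree_iff, ← hGen]
    exact (isTorsionPair_gen (ht.isSilting hT).ext).torsionFree_iff Z

end IsLwCotorsionTorsion

theorem addClosure_eq_iff_isSilting_and_tripleOf_eq {t : SubcatTriple A}
    (ht : IsLwCotorsionTorsion t) {T : FGModuleCat.{u} A} :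
    addClosure T = t.C ⊓ t.T ↔ IsSilting T ∧ tripleOf T = t := by
  refine ⟨fun hT => ⟨ht.isSilting hT, ht.tripleOf_eq hT⟩, ?_⟩
  rintro ⟨hT, rfl⟩
  exact hT.addClosure_eq

end Silting

section Tilting

theorem IsCotorsionTorsion.isLwCotorsionTorsion {t : SubcatTriple A} (ht : IsCotorsionTorsion t) :
    IsLwCotorsionTorsion t :=
  ⟨ht.1.toIsLeftWeakCotorsionPair, ht.2⟩

theorem exists_section_of_lift {K Q Z : Type*} [AddCommGroup K] [Module A K] [AddCommGroup Q]
    [Module A Q] [AddCommGroup Z] [Module A Z] {ρ : Q →ₗ[A] K} (hρ : Function.Surjective ρ)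
    {g : Q →ₗ[A] Z} (hg : Function.Injective g) {s : K →ₗ[A] Z}
    (hs : ((LinearMap.ker ρ).map g).mkQ ∘ₗ s ∘ₗ ρ = ((LinearMap.ker ρ).map g).mkQ ∘ₗ g) :
    ∃ σ : K →ₗ[A] Q, ρ ∘ₗ σ = LinearMap.id := by
  have hsec (x : K) : ∃ y : Q, g y = s x ∧ ρ y = x := by
    obtain ⟨y, rfl⟩ := hρ x
    obtain ⟨w, hw, hgw⟩ := (Submodule.Quotient.eq _).1 (LinearMap.congr_fun hs y)
    refine ⟨w + y, ?_, ?_⟩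
    · rw [map_add, hgw]
      exact sub_add_cancel _ _
    · rw [map_add, LinearMap.mem_ker.1 hw, zero_add]
  have hsg (x : K) : s x ∈ LinearMap.range g := (hsec x).imp fun _ => And.left
  refine ⟨(LinearEquiv.ofInjective g hg).symm.toLinearMap ∘ₗ s.codRestrict _ hsg,
    LinearMap.ext fun x => ?_⟩
  obtain ⟨y, hy, hyx⟩ := hsec x
  have hyx' : (LinearEquiv.ofInjective g hg).symm ⟨s x, hsg x⟩ = y :=
    (LinearEquiv.symm_apply_eq _).2 (Subtype.ext hy.symm)
  exact (congrArg ρ hyx').trans hyx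

variable [IsNoetherianRing A] {T : FGModuleCat.{u} A}

namespace IsTilting

theorem extPerp_gen (hT : IsTilting T) : extPerp (Gen T) T := by
  rintro X ⟨n, f, hf⟩
  exact (hT.ext_self.pi n).of_surjective hT.projectiveDimension_le_one hf

theorem exists_isApproxSequence (hT : IsTilting T) :
    ∃ (Y X : FGModuleCat.{u} A) (g : A →ₗ[A] Y) (p : Y →ₗ[A] X), addClosure T Y ∧
      addClosure T X ∧ IsApproxSequence (Gen T) g p ∧ Function.Injective g := by
  obtain ⟨Y, X, g, p, hY, hX, hg, hgp, hp⟩ := hT.coresolution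
  have hext : extPerp (Gen T) X := extPerp_addClosure hT.extPerp_gen hX
  exact ⟨Y, X, g, p, hY, hX, ⟨hgp, hp, gen_of_addClosure hY, hext, fun Z hZ h =>
    (hext Z hZ).exists_extend (K := FGModuleCat.of A A) ⟨hg, hgp, hp⟩ h⟩, hg⟩

theorem isSilting (hT : IsTilting T) : IsSilting T := by
  obtain ⟨Y, X, g, p, hY, hX, hs, -⟩ := hT.exists_isApproxSequence
  exact ⟨hT.extPerp_gen, Y, X, g, p, hY, hX, hs⟩

theorem isCotorsionTorsion (hT : IsTilting T) : IsCotorsionTorsion (tripleOf T) := by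
  obtain ⟨Y, X, g, p, -, -, hs, hg⟩ := hT.exists_isApproxSequence
  exact ⟨hs.isCotorsionPair (isTorsionClass_gen hT.extPerp_gen) hg,
    isTorsionPair_gen hT.extPerp_gen⟩

end IsTilting

theorem hasProjectiveDimensionLE_one_of_extPerp {𝒯 : ObjectProperty (FGModuleCat.{u} A)}
    (h𝒯 : IsTorsionClass 𝒯) (hT : extPerp 𝒯 T)
    (h : ∀ M : FGModuleCat.{u} A, ∃ (Z : FGModuleCat.{u} A) (g : M →ₗ[A] Z), 𝒯 Z ∧
      Function.Injective g) : HasProjectiveDimensionLE T.obj 1 := by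
  obtain ⟨n, K, i, π, hiπ⟩ := exists_isShortExact_free T
  obtain ⟨m, ρ, hρ⟩ := Module.Finite.exists_fin' A K
  obtain ⟨Z, g, hZ, hg⟩ := h (FGModuleCat.of A (Fin m → A))
  let U : Submodule A Z := (LinearMap.ker ρ).map g
  have hZU : 𝒯 (FGModuleCat.of A (Z ⧸ U)) :=
    h𝒯.of_surjective (Y := FGModuleCat.of A (Z ⧸ U)) hZ U.mkQ_surjective
  obtain ⟨c, hc⟩ := exists_comp_eq_of_exact (LinearMap.exact_subtype_ker_map ρ) hρ
    (U.mkQ ∘ₗ g) (LinearMap.ext fun x => (Submodule.Quotient.mk_eq_zero U).2 ⟨x, x.2, rfl⟩)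
  obtain ⟨b, hb⟩ := (hT _ hZU).exists_extend (E := FGModuleCat.of A (Fin n → A)) hiπ c
  obtain ⟨s, hs⟩ := Module.projective_lifting_property U.mkQ b U.mkQ_surjective
  obtain ⟨σ, hσ⟩ := exists_section_of_lift (s := s ∘ₗ i) hρ hg (by
    rw [← LinearMap.comp_assoc, ← LinearMap.comp_assoc, hs, hb, hc])
  have : Module.Projective A K := Module.Projective.of_split σ ρ hσ
  exact hasProjectiveDimensionLE_one_of_isShortExact (P := FGModuleCat.of A (Fin n → A)) hiπ

theorem IsCotorsionTorsion.isTilting {t : SubcatTriple A} (ht : IsCotorsionTorsion t)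
    (hT : addClosure T = t.C ⊓ t.T) : IsTilting T := by
  have hC := ht.isLwCotorsionTorsion.1.eq_extPerp
  have h𝒯 := ht.2.isTorsionClass
  have hTT : (t.C ⊓ t.T) T := hT ▸ addClosure_self
  obtain ⟨Y, g, hg, hginj⟩ := ht.1.left_sequence_injective (FGModuleCat.of A A)
  obtain ⟨X, p, hs⟩ := hg.exists_isApproxSequence hC.le
  refine ⟨hasProjectiveDimensionLE_one_of_extPerp h𝒯 (hC ▸ hTT.1) fun M => ?_,
    ht.1.ext_vanishes T T hTT.1 hTT.2, Y, X, g, p, ?_, ?_, hginj, hs.exact, hs.surjective⟩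
  · obtain ⟨Z, f, ⟨W, q, -, hZ, -⟩, hf⟩ := ht.1.left_sequence_injective M
    exact ⟨Z, f, hZ, hf⟩
  · rw [hT, hC]
    exact ⟨hs.extPerp_middle h𝒯, hs.mem⟩
  · rw [hT, hC]
    exact ⟨hs.ext, hs.mem_right h𝒯⟩

end Tilting

/-! ### Krull–Schmidt decompositions -/

section KrullSchmidt

theorem isoClass_eq_iff {X Y : FGModuleCat.{u} A} :
    isoClass X = isoClass Y ↔ Nonempty (X ≃ₗ[A] Y) := by
  constructor
  · intro h
    obtain ⟨i⟩ := Quotient.exact h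
    exact ⟨FGModuleCat.isoToLinearEquiv i⟩
  · rintro ⟨e⟩
    exact Quotient.sound ⟨e.toFGModuleCatIso⟩

section Pi

variable {ι : Type*} {X : ι → FGModuleCat.{u} A} {M T : FGModuleCat.{u} A}

theorem sum_comp_single_comp_proj_comp [Fintype ι] [DecidableEq ι] {Y Z : Type*} [AddCommGroup Y]
    [Module A Y] [AddCommGroup Z] [Module A Z] (a : Y →ₗ[A] ∀ i, X i) (b : (∀ i, X i) →ₗ[A] Z) :
    ∑ i, (b ∘ₗ LinearMap.single A (fun i => (X i : Type u)) i) ∘ₗ (LinearMap.proj i ∘ₗ a) =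
      b ∘ₗ a := by
  ext y
  simp only [LinearMap.sum_apply, LinearMap.comp_apply, LinearMap.proj_apply,
    LinearMap.single_apply, ← map_sum, Finset.univ_sum_single]

theorem addClosure_of_equiv_pi [Finite ι] (e : M ≃ₗ[A] ∀ i, X i) (h : ∀ i, addClosure T (X i)) :
    addClosure T M := by
  classical
  have := Fintype.ofFinite ι
  rw [addClosure_iff_factorsThrough_id, ← e.symm_comp, ← sum_comp_single_comp_proj_comp]
  exact FactorsThrough.sum _ fun i _ =>
    (addClosure_iff_factorsThrough_id.1 (h i)).comp_of_id _ _

theorem addClosure_apply_of_equiv_pi (e : M ≃ₗ[A] ∀ i, X i) (i : ι) : addClosure M (X i) := by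
  classical
  refine addClosure_of_isDirectSummand ⟨e.symm.toLinearMap ∘ₗ
    LinearMap.single A (fun i => (X i : Type u)) i, LinearMap.proj i ∘ₗ e.toLinearMap, ?_⟩
  ext x
  simp

end Pi

theorem isDirectSummand_of_isUnit {X Y : Type*} [AddCommGroup X] [Module A X] [AddCommGroup Y]
    [Module A Y] {a : X →ₗ[A] Y} {b : Y →ₗ[A] X} (h : IsUnit (b ∘ₗ a : Module.End A X)) :
    IsDirectSummand (A := A) X Y := by
  obtain ⟨w, hw⟩ := h
  refine ⟨a, (↑w⁻¹ : Module.End A X) ∘ₗ b, ?_⟩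
  rw [LinearMap.comp_assoc, ← hw]
  exact w.inv_mul

namespace IsIndecomposable

theorem nonempty_equiv {X Y : FGModuleCat.{u} A} [Nontrivial X] (hY : IsIndecomposable Y)
    (h : IsDirectSummand (A := A) X Y) : Nonempty (X ≃ₗ[A] Y) := by
  obtain ⟨i, r, hri⟩ := h
  have hri' (x : X) : r (i x) = x := LinearMap.congr_fun hri x
  have hidem : IsIdempotentElem (i ∘ₗ r : Module.End A Y) :=
    LinearMap.ext fun y => congrArg i (hri' (r y))
  rcases hY.2 _ _ (LinearMap.IsIdempotentElem.isCompl hidem) with hrange | hker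
  · obtain ⟨x, hx⟩ := exists_ne (0 : X)
    have hir : i ∘ₗ r = 0 := LinearMap.range_eq_bot.1 hrange
    refine absurd ?_ hx
    rw [← hri' x, ← hri' x, ← LinearMap.comp_apply i r, hir, LinearMap.zero_apply, map_zero]
  · have hr : Function.Injective r := Function.Injective.of_comp (LinearMap.ker_eq_bot.1 hker)
    exact ⟨(LinearEquiv.ofBijective r ⟨hr, fun x => ⟨i x, hri' x⟩⟩).symm⟩

variable [IsArtinianRing A] {X : FGModuleCat.{u} A}

theorem isNilpotent_or_isUnit (hX : IsIndecomposable X) (f : Module.End A X) :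
    IsNilpotent f ∨ IsUnit f := by
  obtain ⟨n, hn, hn0⟩ := ((f.eventually_isCompl_ker_pow_range_pow).and
    (Filter.eventually_ne_atTop 0)).exists
  rcases hX.2 _ _ hn with hker | hrange
  · refine .inr ((isUnit_pow_iff hn0).1 ((Module.End.isUnit_iff _).2 ?_))
    exact IsArtinian.bijective_of_injective_endomorphism _ (LinearMap.ker_eq_bot.1 hker)
  · exact .inl ⟨n, LinearMap.range_eq_bot.1 hrange⟩

theorem isLocalRing_end (hX : IsIndecomposable X) : IsLocalRing (Module.End A X) := by
  have := hX.1
  exact .of_isUnit_or_isUnit_one_sub_self fun f =>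
    (hX.isNilpotent_or_isUnit f).symm.imp_right IsNilpotent.isUnit_one_sub

theorem exists_isUnit (hX : IsIndecomposable X) {ι : Type*} {s : Finset ι}
    {f : ι → Module.End A X} (hf : ∑ i ∈ s, f i = LinearMap.id) : ∃ i ∈ s, IsUnit (f i) := by
  have := hX.isLocalRing_end
  exact IsLocalRing.exists_of_isUnit_sum (hf ▸ isUnit_one)

theorem isDirectSummand (hX : IsIndecomposable X) {T : FGModuleCat.{u} A} (h : addClosure T X) :
    IsDirectSummand (A := A) X T := by
  obtain ⟨n, a, b, hab⟩ := addClosure_iff_factorsThrough_id.1 h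
  obtain ⟨i, -, hi⟩ := hX.exists_isUnit hab.symm
  exact isDirectSummand_of_isUnit hi

theorem exists_isDirectSummand_pi (hX : IsIndecomposable X) {ι : Type*} [Finite ι]
    {Y : ι → FGModuleCat.{u} A} (h : IsDirectSummand (A := A) X (∀ i, Y i)) :
    ∃ i, IsDirectSummand (A := A) X (Y i) := by
  classical
  have := Fintype.ofFinite ι
  obtain ⟨a, b, hab⟩ := h
  obtain ⟨i, -, hi⟩ := hX.exists_isUnit ((sum_comp_single_comp_proj_comp a b).trans hab)
  exact ⟨i, isDirectSummand_of_isUnit hi⟩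

theorem exists_equiv (hX : IsIndecomposable X) {M : FGModuleCat.{u} A} {ι : Type*} [Finite ι]
    {Y : ι → FGModuleCat.{u} A} (hY : ∀ i, IsIndecomposable (Y i)) (e : M ≃ₗ[A] ∀ i, Y i)
    (h : addClosure M X) : ∃ i, Nonempty (X ≃ₗ[A] Y i) := by
  have := hX.1
  obtain ⟨a, b, hab⟩ := hX.isDirectSummand h
  obtain ⟨i, hi⟩ := hX.exists_isDirectSummand_pi (Y := Y)
    ⟨e.toLinearMap ∘ₗ a, b ∘ₗ e.symm.toLinearMap, by
      rw [← hab]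
      ext x
      simp⟩
  exact ⟨i, (hY i).nonempty_equiv hi⟩

end IsIndecomposable

theorem map_subtype_lt_of_isCompl {M : Type*} [AddCommGroup M] [Module A M] {N : Submodule A M}
    {P Q : Submodule A N} (h : IsCompl P Q) (hQ : Q ≠ ⊥) : P.map N.subtype < N := by
  have hP : P < ⊤ := lt_top_iff_ne_top.2 fun hP =>
    hQ (h.disjoint.eq_bot_of_ge (hP ▸ le_top))
  simpa only [Submodule.map_subtype_top] using
    Submodule.map_strictMono_of_injective N.injective_subtype hP

variable [IsArtinianRing A]

theorem exists_indecomposable_decomposition (M : FGModuleCat.{u} A) :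
    ∃ (ι : Type) (_ : Fintype ι) (X : ι → FGModuleCat.{u} A), (∀ i, IsIndecomposable (X i)) ∧
      Nonempty (M ≃ₗ[A] ∀ i, X i) := by
  suffices H : ∀ N : Submodule A M, ∃ (ι : Type) (_ : Fintype ι) (X : ι → FGModuleCat.{u} A),
      (∀ i, IsIndecomposable (X i)) ∧ Nonempty (N ≃ₗ[A] ∀ i, X i) by
    obtain ⟨ι, hι, X, hX, ⟨e⟩⟩ := H ⊤
    exact ⟨ι, hι, X, hX, ⟨Submodule.topEquiv.symm ≪≫ₗ e⟩⟩
  intro N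
  induction N using WellFoundedLT.induction with
  | ind N ih =>
  rcases subsingleton_or_nontrivial N with hN | hN
  · exact ⟨Empty, inferInstance, Empty.elim, fun i => i.elim,
      ⟨LinearEquiv.ofSubsingleton _ _⟩⟩
  · by_cases hind : IsIndecomposable (FGModuleCat.of A N)
    · exact ⟨Unit, inferInstance, fun _ => FGModuleCat.of A N, fun _ => hind,
        ⟨(LinearEquiv.funUnique Unit A N).symm⟩⟩
    · obtain ⟨P, Q, hPQ, hP, hQ⟩ : ∃ P Q : Submodule A N, IsCompl P Q ∧ P ≠ ⊥ ∧ Q ≠ ⊥ := by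
        by_contra! h
        exact hind ⟨hN, fun P Q hPQ => or_iff_not_imp_left.2 (h P Q hPQ)⟩
      obtain ⟨ι, hι, X, hX, ⟨e⟩⟩ := ih _ (map_subtype_lt_of_isCompl hPQ hQ)
      obtain ⟨κ, hκ, Y, hY, ⟨f⟩⟩ := ih _ (map_subtype_lt_of_isCompl hPQ.symm hP)
      have e' := Submodule.equivMapOfInjective _ N.injective_subtype P ≪≫ₗ e
      have f' := Submodule.equivMapOfInjective _ N.injective_subtype Q ≪≫ₗ f
      exact ⟨ι ⊕ κ, inferInstance, Sum.elim X Y, Sum.rec hX hY,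
        ⟨(Submodule.prodEquivOfIsCompl P Q hPQ).symm ≪≫ₗ LinearEquiv.prodCongr e' f' ≪≫ₗ
          (LinearEquiv.sumPiEquivProdPi A ι κ fun i => (Sum.elim X Y i : FGModuleCat.{u} A)).symm⟩⟩

theorem exists_isIndecomposable_addClosure (M : FGModuleCat.{u} A) [Nontrivial M] :
    ∃ X : FGModuleCat.{u} A, IsIndecomposable X ∧ addClosure M X := by
  obtain ⟨ι, _, X, hX, ⟨e⟩⟩ := exists_indecomposable_decomposition M
  rcases isEmpty_or_nonempty ι with h | ⟨⟨i⟩⟩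
  · exact absurd e.toEquiv.subsingleton (not_subsingleton M)
  · exact ⟨X i, hX i, addClosure_apply_of_equiv_pi e i⟩

theorem exists_isBasic_addClosure_eq (M : FGModuleCat.{u} A) :
    ∃ T : FGModuleCat.{u} A, IsBasic T ∧ addClosure T = addClosure M := by
  obtain ⟨ι, _, X, hX, ⟨e⟩⟩ := exists_indecomposable_decomposition M
  let c : ι → IsoClass A := fun i => isoClass (X i)
  let a := Finite.equivFin (Set.range c)
  let Y (j : Fin _) : FGModuleCat.{u} A := X (Set.rangeSplitting c (a.symm j))
  have hY (j : Fin _) : isoClass (Y j) = a.symm j := Set.apply_rangeSplitting c _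
  let T := FGModuleCat.of A (∀ j, Y j)
  have hT : IsBasic T := by
    refine ⟨_, Y, fun j => hX _, fun i j hij => ?_, ⟨LinearEquiv.refl A T⟩⟩
    refine a.symm.injective (Subtype.ext ?_)
    rw [← hY, ← hY, isoClass_eq_iff.2 hij]
  refine ⟨T, hT, le_antisymm (addClosure_le ?_) (addClosure_le ?_)⟩
  · exact addClosure_of_equiv_pi (LinearEquiv.refl A T) fun j => addClosure_apply_of_equiv_pi e _
  · refine addClosure_of_equiv_pi e fun i => ?_
    obtain ⟨f⟩ := isoClass_eq_iff.1 ((hY (a ⟨c i, i, rfl⟩)).trans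
      (congrArg Subtype.val (a.symm_apply_apply _)))
    exact (addClosure_apply_of_equiv_pi (LinearEquiv.refl A T) _).trans (addClosure_of_equiv f)

theorem IsBasic.nonempty_equiv {T T' : FGModuleCat.{u} A} (hT : IsBasic T) (hT' : IsBasic T')
    (h : addClosure T = addClosure T') : Nonempty (T ≃ₗ[A] T') := by
  obtain ⟨n, X, hX, hXi, ⟨e⟩⟩ := hT
  obtain ⟨m, Y, hY, hYi, ⟨f⟩⟩ := hT'
  choose σ hσ using fun i => (hX i).exists_equiv hY f (h ▸ addClosure_apply_of_equiv_pi e i)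
  choose τ hτ using fun j => (hY j).exists_equiv hX e (h ▸ addClosure_apply_of_equiv_pi f j)
  let w : Fin n ≃ Fin m :=
    { toFun := σ
      invFun := τ
      left_inv := fun i => (hXi _ _ ⟨(hσ i).some ≪≫ₗ (hτ (σ i)).some⟩).symm
      right_inv := fun j => (hYi _ _ ⟨(hτ j).some ≪≫ₗ (hσ (τ j)).some⟩).symm }
  exact ⟨e ≪≫ₗ LinearEquiv.piCongrRight (fun i => (hσ i).some) ≪≫ₗ
    LinearEquiv.piCongrLeft A (fun j => (Y j : Type u)) w ≪≫ₗ f.symm⟩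

/-- `X` is a system of representatives of the isomorphism classes of indecomposable direct summands
of `M`. Membership in `add M` replaces being a direct summand: the two agree for indecomposable
modules over Artinian rings. -/
structure IsSummandSystem {ι : Type*} (X : ι → FGModuleCat.{u} A) (M : FGModuleCat.{u} A) :
    Prop where
  isIndecomposable (i : ι) : IsIndecomposable (X i)
  eq_of_equiv (i j : ι) : Nonempty (X i ≃ₗ[A] X j) → i = j
  addClosure (i : ι) : addClosure M (X i)
  exists_equiv (Y : FGModuleCat.{u} A) : IsIndecomposable Y → WeakCotorsion.addClosure M Y →
    ∃ i, Nonempty (Y ≃ₗ[A] X i)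

theorem exists_isSummandSystem (M : FGModuleCat.{u} A) :
    ∃ (m : ℕ) (X : Fin m → FGModuleCat.{u} A), IsSummandSystem X M := by
  obtain ⟨T, ⟨m, X, hX, hXi, ⟨e⟩⟩, hTM⟩ := exists_isBasic_addClosure_eq M
  exact ⟨m, X, hX, hXi, fun i => hTM ▸ addClosure_apply_of_equiv_pi e i,
    fun Y hY h => hY.exists_equiv hX e (hTM ▸ h)⟩

theorem IsSummandSystem.numIndecomposableSummands_eq {ι : Type*} [Fintype ι]
    {X : ι → FGModuleCat.{u} A} {M : FGModuleCat.{u} A} (h : IsSummandSystem X M) :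
    numIndecomposableSummands M = Fintype.card ι := by
  have hset : {c : IsoClass A | ∃ X : FGModuleCat.{u} A, isoClass X = c ∧ IsIndecomposable X ∧
      IsDirectSummand (A := A) X M} = Set.range fun i => isoClass (X i) := by
    ext c
    constructor
    · rintro ⟨Y, rfl, hY, hYM⟩
      obtain ⟨i, ⟨f⟩⟩ := h.exists_equiv Y hY (addClosure_of_isDirectSummand hYM)
      exact ⟨i, isoClass_eq_iff.2 ⟨f.symm⟩⟩
    · rintro ⟨i, rfl⟩
      have hi := h.isIndecomposable i
      exact ⟨X i, rfl, hi, hi.isDirectSummand (h.addClosure i)⟩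
  rw [numIndecomposableSummands, hset, ← Set.image_univ,
    Function.Injective.encard_image fun i j hij => h.eq_of_equiv i j (isoClass_eq_iff.1 hij),
    Set.encard_univ, ENat.card_eq_coe_fintype_card]

theorem injOn_tripleMap_isSilting :
    Set.InjOn tripleMap (isoClass '' {T : FGModuleCat.{u} A | IsBasic T ∧ IsSilting T}) := by
  rintro _ ⟨T, ⟨hb, hT⟩, rfl⟩ _ ⟨T', ⟨hb', hT'⟩, rfl⟩ h
  refine isoClass_eq_iff.2 (hb.nonempty_equiv hb' ?_)
  rw [hT.addClosure_eq, hT'.addClosure_eq]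
  exact congrArg (fun t => t.C ⊓ t.T) (show tripleOf T = tripleOf T' from h)

theorem bijOn_tripleMap_isSilting :
    Set.BijOn tripleMap (isoClass '' {T : FGModuleCat.{u} A | IsBasic T ∧ IsSilting T})
      {t | IsLwCotorsionTorsion t} := by
  refine ⟨?_, injOn_tripleMap_isSilting, fun t ht => ?_⟩
  · rintro _ ⟨T, ⟨-, hT⟩, rfl⟩
    exact hT.isLwCotorsionTorsion
  · obtain ⟨M, hM⟩ := ht.exists_addClosure_eq
    obtain ⟨T, hb, hT⟩ := exists_isBasic_addClosure_eq M
    exact ⟨_, ⟨T, ⟨hb, ht.isSilting (hT.trans hM)⟩, rfl⟩, ht.tripleOf_eq (hT.trans hM)⟩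

theorem bijOn_tripleMap_basicTilting :
    Set.BijOn tripleMap (basicTilting A) {t | IsCotorsionTorsion t} := by
  refine ⟨?_, injOn_tripleMap_isSilting.mono (Set.image_mono ?_), fun t ht => ?_⟩
  · rintro _ ⟨T, ⟨-, hT⟩, rfl⟩
    exact hT.isCotorsionTorsion
  · exact fun T hT => ⟨hT.1, hT.2.isSilting⟩
  · obtain ⟨M, hM⟩ := ht.isLwCotorsionTorsion.exists_addClosure_eq
    obtain ⟨T, hb, hT⟩ := exists_isBasic_addClosure_eq M
    exact ⟨_, ⟨T, ⟨hb, ht.isTilting (hT.trans hM)⟩, rfl⟩,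
      ht.isLwCotorsionTorsion.tripleOf_eq (hT.trans hM)⟩

end KrullSchmidt

/-! ### Rigidity and the Auslander–Reiten translation -/

section HomSurjective

/-- Every map from `P₁` to `X` extends along `d : P₁ → P₀`. For a projective presentation `d` of
`M` this is the vanishing of `Hom(X, τ M)`, phrased without `τ`. -/
def HomSurjective {P₁ P₀ : Type*} [AddCommGroup P₁] [Module A P₁] [AddCommGroup P₀] [Module A P₀]
    (d : P₁ →ₗ[A] P₀) (X : Type*) [AddCommGroup X] [Module A X] : Prop :=
  ∀ h : P₁ →ₗ[A] X, ∃ g : P₀ →ₗ[A] X, g ∘ₗ d = h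

theorem HomSurjective.of_exact {P₁ P₀ X Y Z : Type*} [AddCommGroup P₁] [Module A P₁]
    [AddCommGroup P₀] [Module A P₀] [Module.Projective A P₁] [Module.Projective A P₀]
    {d : P₁ →ₗ[A] P₀} [AddCommGroup X] [Module A X] [AddCommGroup Y] [Module A Y]
    [AddCommGroup Z] [Module A Z] {i : X →ₗ[A] Y} {p : Y →ₗ[A] Z} (hip : Function.Exact i p)
    (hp : Function.Surjective p) (hi : ∀ f : P₁ →ₗ[A] X, ∃ g : P₀ →ₗ[A] Y, g ∘ₗ d = i ∘ₗ f)
    (hZ : HomSurjective d Z) : HomSurjective d Y := by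
  intro h
  obtain ⟨g, hg⟩ := hZ (p ∘ₗ h)
  obtain ⟨g, rfl⟩ := Module.projective_lifting_property p g hp
  obtain ⟨f, hf⟩ := exists_comp_eq_of_projective hip (g := h - g ∘ₗ d)
    (by rw [LinearMap.comp_sub, ← LinearMap.comp_assoc, hg, sub_self])
  obtain ⟨c, hc⟩ := hi f
  exact ⟨c + g, by rw [LinearMap.add_comp, hc, hf, sub_add_cancel]⟩

theorem isTorsionClass_homSurjective {P₁ P₀ : Type*} [AddCommGroup P₁] [Module A P₁]
    [AddCommGroup P₀] [Module A P₀] [Module.Projective A P₁] [Module.Projective A P₀]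
    (d : P₁ →ₗ[A] P₀) : IsTorsionClass (fun X : FGModuleCat.{u} A => HomSurjective d X) where
  of_surjective {X Y f} hX hf h := by
    obtain ⟨h', rfl⟩ := Module.projective_lifting_property f h hf
    obtain ⟨g, rfl⟩ := hX h'
    exact ⟨f ∘ₗ g, LinearMap.comp_assoc _ _ _⟩
  of_isShortExact {X E Z i p} hip hX hZ := hZ.of_exact hip.exact hip.surjective fun f => by
    obtain ⟨g, rfl⟩ := hX f
    exact ⟨i ∘ₗ g, LinearMap.comp_assoc _ _ _⟩

variable {P₁ P₀ M N : FGModuleCat.{u} A} {d : P₁ →ₗ[A] P₀} {π : P₀ →ₗ[A] M}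

theorem HomSurjective.extOneVanishes [Module.Projective A P₀] (hdπ : Function.Exact d π)
    (hπ : Function.Surjective π) [IsNoetherianRing A] (hN : HomSurjective d N) :
    ExtOneVanishes M N := by
  refine extOneVanishes_of_forall_exists_extend (K := FGModuleCat.of A (LinearMap.ker π))
    (isShortExact_subtype_ker hπ) fun f => ?_
  let d' : P₁ →ₗ[A] LinearMap.ker π := d.codRestrict _ hdπ.apply_apply_eq_zero
  have hd' : Function.Surjective d' := fun x => by
    obtain ⟨y, hy⟩ := (hdπ x.1).1 x.2
    exact ⟨y, Subtype.ext hy⟩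
  obtain ⟨g, hg⟩ := hN (f ∘ₗ d')
  exact ⟨g, (LinearMap.cancel_right hd').1 hg⟩

theorem IsSuperfluous.eq_zero_of_range_le_map {P N : Type*} [AddCommGroup P] [Module A P]
    [AddCommGroup N] [Module A N] {K : Submodule A P} (hK : IsSuperfluous K) {f : P →ₗ[A] N}
    (h : LinearMap.range f ≤ K.map f) : f = 0 := by
  refine LinearMap.ker_eq_top.1 (hK _ ?_)
  rw [sup_comm, ← Submodule.comap_map_eq, eq_top_iff]
  exact fun x _ => h ⟨x, rfl⟩

theorem exists_range_sub_comp_le [Module.Projective A P₀]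
    (hdπ : Function.Exact d π) (hπ : Function.Surjective π) (f : P₁ →ₗ[A] N)
    (h : ExtOneVanishes M (FGModuleCat.of A (N ⧸ (LinearMap.ker d).map f))) :
    ∃ g : P₀ →ₗ[A] N, LinearMap.range (f - g ∘ₗ d) ≤ (LinearMap.ker d).map f := by
  let U := (LinearMap.ker d).map f
  have hd := isShortExact_subtype_ker d.surjective_rangeRestrict
  obtain ⟨c, hc⟩ := exists_comp_eq_of_exact hd.exact hd.surjective (U.mkQ ∘ₗ f) (by
    ext x
    exact (Submodule.Quotient.mk_eq_zero _).2 ⟨x, d.ker_rangeRestrict ▸ x.2, rfl⟩)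
  have hdπ' : IsShortExact (LinearMap.range d).subtype π :=
    ⟨Subtype.val_injective, fun x => (hdπ x).trans (by simp), hπ⟩
  obtain ⟨b, hb⟩ := h.exists_extend (K := FGModuleCat.of A (LinearMap.range d)) hdπ' c
  obtain ⟨g, rfl⟩ := Module.projective_lifting_property U.mkQ b U.mkQ_surjective
  refine ⟨g, (?_ : _ ≤ U)⟩
  rw [← U.ker_mkQ, LinearMap.range_le_ker_iff, LinearMap.comp_sub, ← hc, ← hb, sub_eq_zero]
  rfl

theorem MinimalPresentation.homSurjective [IsArtinianRing A] (P : MinimalPresentation M)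
    (h : extPerp (Gen N) M) : HomSurjective P.d N := by
  intro f
  have := P.cover₀.projective
  let S : Set (Submodule A N) :=
    {R | ∃ g : P.P₀ →ₗ[A] N, R = LinearMap.range (f - g ∘ₗ P.d)}
  obtain ⟨R, ⟨g, rfl⟩, hmin⟩ := WellFounded.has_min wellFounded_lt S ⟨_, 0, rfl⟩
  obtain ⟨g', hg'⟩ := exists_range_sub_comp_le P.exact P.cover₀.surjective (f - g ∘ₗ P.d)
    (h _ (gen_self.of_surjective (Submodule.mkQ_surjective _)))
  have hmem : LinearMap.range (f - g ∘ₗ P.d - g' ∘ₗ P.d) ∈ S :=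
    ⟨g + g', by rw [LinearMap.add_comp, sub_sub]⟩
  have hle : LinearMap.range (f - g ∘ₗ P.d) ≤ (LinearMap.ker P.d).map (f - g ∘ₗ P.d) :=
    (eq_of_le_of_not_lt (hg'.trans LinearMap.map_le_range) (hmin _ hmem)).ge.trans hg'
  have hsup : IsSuperfluous (LinearMap.ker P.d) :=
    P.d.ker_rangeRestrict ▸ P.cover₁.superfluous
  exact ⟨g, (sub_eq_zero.1 (hsup.eq_zero_of_range_le_map hle)).symm⟩

end HomSurjective

section Tau

section DualBasis

variable {P : Type*} [AddCommGroup P] [Module A P]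

theorem exists_dualBasis (P : Type*) [AddCommGroup P] [Module A P] [Module.Finite A P]
    [Module.Projective A P] :
    ∃ (n : ℕ) (x : Fin n → P) (φ : Fin n → P →ₗ[A] A), ∀ p, ∑ i, φ i p • x i = p := by
  obtain ⟨n, f, hf⟩ := Module.Finite.exists_fin' A P
  obtain ⟨s, hs⟩ := Module.projective_lifting_property f LinearMap.id hf
  refine ⟨n, fun i => f (Pi.single i 1), fun i => LinearMap.proj i ∘ₗ s, fun p => ?_⟩
  simp only [← map_smul, ← map_sum, LinearMap.comp_apply, LinearMap.proj_apply,
    ← Pi.single_smul, smul_eq_mul, mul_one, Finset.univ_sum_single]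
  exact LinearMap.congr_fun hs p

variable {n : ℕ} {x : Fin n → P} {φ : Fin n → P →ₗ[A] A} (hφ : ∀ p, ∑ i, φ i p • x i = p)
include hφ

theorem sum_op_smul_eq (χ : P →ₗ[A] A) : ∑ i, MulOpposite.op (χ (x i)) • φ i = χ := by
  ext p
  conv_rhs => rw [← hφ p]
  simp

theorem sum_smulRight_eq {N : Type*} [AddCommGroup N] [Module A N] (c : P →ₗ[A] N) :
    ∑ i, (φ i).smulRight (c (x i)) = c := by
  ext p
  conv_rhs => rw [← hφ p]
  simp

end DualBasis

variable (k : Type v) [Field k]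

instance (X : Type*) [AddCommGroup X] [Module k X] [Module Aᵐᵒᵖ X] [SMulCommClass Aᵐᵒᵖ k X] :
    AddMonoidHomClass (KDual k A X) X k :=
  inferInstanceAs (AddMonoidHomClass (X →ₗ[k] k) X k)

variable {k} in
theorem KDual.add_apply {X : Type*} [AddCommGroup X] [Module k X] [Module Aᵐᵒᵖ X]
    [SMulCommClass Aᵐᵒᵖ k X] (f g : KDual k A X) (x : X) : (f + g) x = f x + g x :=
  rfl

variable {k} in
theorem exists_addMonoidHom_smulRight_eq {P N X : Type*} [AddCommGroup P] [Module A P]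
    [Module.Finite A P] [Module.Projective A P] [AddCommGroup N] [Module A N] [AddCommGroup X]
    [Module k X] [Module Aᵐᵒᵖ X] [SMulCommClass Aᵐᵒᵖ k X] (q : (P →ₗ[A] A) →ₗ[Aᵐᵒᵖ] X)
    (f : N →ₗ[A] KDual k A X) :
    ∃ Λ : (P →ₗ[A] N) →+ k, ∀ χ z, Λ (χ.smulRight z) = f z (q χ) := by
  obtain ⟨n, x, φ, hφ⟩ := exists_dualBasis (A := A) P
  refine ⟨⟨⟨fun c => ∑ i, f (c (x i)) (q (φ i)), ?_⟩, ?_⟩, fun χ z => ?_⟩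
  · exact Finset.sum_eq_zero fun i _ => by
      rw [LinearMap.zero_apply, map_zero]
      rfl
  · intro c c'
    simp only [LinearMap.add_apply, map_add, KDual.add_apply, Finset.sum_add_distrib]
  · change ∑ i, f (χ (x i) • z) (q (φ i)) = f z (q χ)
    conv_rhs => rw [← sum_op_smul_eq hφ χ]
    simp only [map_smul, map_sum, KDual.smul_apply]

variable [Algebra k A] {M : FGModuleCat.{u} A} (P : MinimalPresentation M) {N : Type*}
  [AddCommGroup N] [Module A N]

theorem eq_zero_of_homSurjective (h : HomSurjective P.d N) (f : N →ₗ[A] KDual k A P.Tr) :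
    f = 0 := by
  have := P.cover₀.projective
  have := P.cover₁.projective
  let q := (LinearMap.range (homDual P.d)).mkQ
  obtain ⟨Λ, hΛ⟩ := exists_addMonoidHom_smulRight_eq q f
  have hΛd (g : P.P₀ →ₗ[A] N) : Λ (g ∘ₗ P.d) = 0 := by
    obtain ⟨m, y, ψ, hψ⟩ := exists_dualBasis (A := A) P.P₀
    have hg : g ∘ₗ P.d = ∑ j, (ψ j ∘ₗ P.d).smulRight (g (y j)) := by
      conv_lhs => rw [← sum_smulRight_eq hψ g]
      ext p
      simp
    rw [hg, map_sum]
    refine Finset.sum_eq_zero fun j _ => ?_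
    have hj : q (ψ j ∘ₗ P.d) = 0 := (Submodule.Quotient.mk_eq_zero _).2 ⟨ψ j, rfl⟩
    rw [hΛ, hj, map_zero]
  refine LinearMap.ext fun z => LinearMap.ext (f := (f z : P.Tr →ₗ[k] k)) (g := 0) fun t => ?_
  obtain ⟨χ, rfl⟩ := Submodule.mkQ_surjective _ t
  obtain ⟨g, hg⟩ := h (χ.smulRight z)
  exact (hΛ χ z).symm.trans (hg ▸ hΛd g)

variable [Module k N] [IsScalarTower k A N]

variable {k P} in
theorem exists_hom_kDual_apply_eq {l : (P.P₁ →ₗ[A] N) →ₗ[k] k} (hl : ∀ g, l (g ∘ₗ P.d) = 0) :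
    ∃ f : N →ₗ[A] KDual k A P.Tr, ∀ z χ,
      f z ((LinearMap.range (homDual P.d)).mkQ χ) = l (χ.smulRight z) := by
  let W := (LinearMap.range (homDual P.d)).restrictScalars k
  let ev (z : N) : (P.P₁ →ₗ[A] A) →ₗ[k] (P.P₁ →ₗ[A] N) :=
    LinearMap.compRight k (LinearMap.toSpanSingleton A N z)
  have hW (z : N) : W ≤ LinearMap.ker (l ∘ₗ ev z) := by
    rintro _ ⟨ψ, rfl⟩
    exact hl (ψ.smulRight z)
  let F (z : N) : KDual k A P.Tr := W.liftQ (l ∘ₗ ev z) (hW z)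
  have hF z χ : F z ((LinearMap.range (homDual P.d)).mkQ χ) = l (χ.smulRight z) := rfl
  have hext (f g : KDual k A P.Tr) (hfg : ∀ χ, f ((LinearMap.range (homDual P.d)).mkQ χ) =
      g ((LinearMap.range (homDual P.d)).mkQ χ)) : f = g := by
    refine LinearMap.ext (f := (f : P.Tr →ₗ[k] k)) (g := g) fun t => ?_
    obtain ⟨χ, rfl⟩ := Submodule.mkQ_surjective _ t
    exact hfg χ
  refine ⟨⟨⟨F, fun z w => hext _ _ fun χ => ?_⟩, fun a z => hext _ _ fun χ => ?_⟩, hF⟩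
  · rw [KDual.add_apply, hF, hF, hF, ← map_add]
    congr 1
    ext p
    exact smul_add _ _ _
  · rw [RingHom.id_apply, KDual.smul_apply, ← map_smul, hF, hF]
    congr 1
    ext p
    exact (mul_smul _ _ _).symm

theorem homSurjective_of_forall_eq_zero (h : ∀ f : N →ₗ[A] KDual k A P.Tr, f = 0) :
    HomSurjective P.d N := by
  have := P.cover₁.projective
  intro c
  by_contra! hc
  obtain ⟨l, hlc, hl⟩ := Submodule.exists_le_ker_of_notMem
    (p := LinearMap.range (LinearMap.lcomp k N P.d)) (v := c) fun ⟨g, hg⟩ => hc g hg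
  obtain ⟨f, hf⟩ := exists_hom_kDual_apply_eq fun g => hl ⟨g, rfl⟩
  obtain ⟨n, x, φ, hφ⟩ := exists_dualBasis (A := A) P.P₁
  apply hlc
  rw [← sum_smulRight_eq hφ c, map_sum]
  refine Finset.sum_eq_zero fun i _ => ?_
  rw [← hf, h f]
  rfl

theorem forall_hom_tau_eq_zero_iff [Module.Finite k A] (M : FGModuleCat.{u} A) :
    (∀ f : M →ₗ[A] tau k M, f = 0) ↔ extPerp (Gen M) M := by
  have : IsArtinianRing A := IsArtinianRing.of_finite k A
  let P := minimalPresentation k M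
  have := P.cover₀.projective
  have := P.cover₁.projective
  constructor
  · intro h X hX
    let : Module k M := Module.compHom M (algebraMap k A)
    have : IsScalarTower k A M := ⟨fun c a x => by rw [Algebra.smul_def, mul_smul]; rfl⟩
    have hM : HomSurjective P.d M := homSurjective_of_forall_eq_zero k P h
    exact ((isTorsionClass_homSurjective P.d).gen_le hM X hX).extOneVanishes P.exact
      P.cover₀.surjective
  · exact fun h => eq_zero_of_homSurjective k P (P.homSurjective h)

end Tau

/-! ### Additive functions and dimensions of spaces of homomorphisms -/

section IsAdditive

/-- An integer-valued function on `mod A` that is additive on short exact sequences, that is, a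
linear form on the Grothendieck group of `mod A`. -/
def IsAdditive (F : FGModuleCat.{u} A → ℤ) : Prop :=
  ∀ ⦃X Y Z : FGModuleCat.{u} A⦄ ⦃i : X →ₗ[A] Y⦄ ⦃p : Y →ₗ[A] Z⦄, IsShortExact i p →
    F Y = F X + F Z

namespace IsAdditive

variable {F G : FGModuleCat.{u} A → ℤ}

theorem sub (hF : IsAdditive F) (hG : IsAdditive G) : IsAdditive fun X => F X - G X := by
  intro X Y Z i p h
  simp only [hF h, hG h]
  ring

theorem sum_mul {ι : Type*} (s : Finset ι) (c : ι → ℤ) {G : ι → FGModuleCat.{u} A → ℤ}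
    (hG : ∀ i, IsAdditive (G i)) : IsAdditive fun X => ∑ i ∈ s, c i * G i X := by
  intro X Y Z i p h
  simp only [fun j => hG j h, mul_add, Finset.sum_add_distrib]

theorem eq_zero_of_subsingleton (hF : IsAdditive F) (X : FGModuleCat.{u} A) [Subsingleton X] :
    F X = 0 := by
  have h : IsShortExact (0 : X →ₗ[A] X) (0 : X →ₗ[A] X) :=
    ⟨fun _ _ _ => Subsingleton.elim _ _,
      fun _ => ⟨fun _ => ⟨0, Subsingleton.elim _ _⟩, fun _ => rfl⟩,
      fun _ => ⟨0, Subsingleton.elim _ _⟩⟩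
  have := hF h
  lia

theorem congr (hF : IsAdditive F) {X Y : FGModuleCat.{u} A} (e : X ≃ₗ[A] Y) : F X = F Y := by
  have h := hF (Z := FGModuleCat.of A PUnit.{u + 1}) (i := e.toLinearMap) (p := 0)
    ⟨e.injective, fun y => ⟨fun _ => e.surjective y, fun _ => rfl⟩, fun _ => ⟨0, rfl⟩⟩
  have : Subsingleton (FGModuleCat.of A PUnit.{u + 1}) := inferInstanceAs (Subsingleton PUnit)
  rw [h, hF.eq_zero_of_subsingleton (FGModuleCat.of A PUnit.{u + 1}), add_zero]

theorem eq_zero [IsArtinianRing A] (hF : IsAdditive F)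
    (h : ∀ S : FGModuleCat.{u} A, IsSimpleModule A S → F S = 0) (X : FGModuleCat.{u} A) :
    F X = 0 := by
  suffices H : ∀ U : Submodule A X, F (FGModuleCat.of A U) = 0 by
    rw [← H ⊤]
    exact hF.congr (Y := FGModuleCat.of A (⊤ : Submodule A X)) Submodule.topEquiv.symm
  intro U
  induction U using WellFoundedLT.induction with
  | ind U ih =>
  rcases eq_or_ne U ⊥ with rfl | hU
  · have : Subsingleton (FGModuleCat.of A (⊥ : Submodule A X)) :=
      inferInstanceAs (Subsingleton (⊥ : Submodule A X))
    exact hF.eq_zero_of_subsingleton _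
  obtain ⟨W, hW⟩ := exists_covBy_of_wellFoundedGT fun h => hU (isMin_iff_eq_bot.1 h)
  have hWU : IsShortExact (Submodule.inclusion hW.le) (W.submoduleOf U).mkQ :=
    ⟨Submodule.inclusion_injective _,
      LinearMap.exact_iff.2 (by rw [Submodule.ker_mkQ, Submodule.range_inclusion]; rfl),
      Submodule.mkQ_surjective _⟩
  have hsimple : F (FGModuleCat.of A (U ⧸ W.submoduleOf U)) = 0 :=
    h _ ((covBy_iff_quot_is_simple hW.le).1 hW)
  rw [hF (X := FGModuleCat.of A W) (Y := FGModuleCat.of A U)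
    (Z := FGModuleCat.of A (U ⧸ W.submoduleOf U)) hWU, ih W hW.lt, hsimple, add_zero]

end IsAdditive

end IsAdditive

section HomDim

variable (k : Type v) [Field k] [Algebra k A]

/-- The `k`-vector space underlying an `A`-module; only ever a local instance, since modules may
carry another `k`-action. -/
@[reducible]
def scalarModule (X : FGModuleCat.{u} A) : Module k X :=
  Module.compHom X (algebraMap k A)

attribute [local instance] scalarModule

theorem isScalarTower_scalarModule (X : FGModuleCat.{u} A) : IsScalarTower k A X :=
  ⟨fun c a x => by rw [Algebra.smul_def, mul_smul]; rfl⟩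

attribute [local instance] isScalarTower_scalarModule

/-- The `k`-dimension of `Hom_A(X, Y)`, as an integer so that dimensions can be subtracted. -/
noncomputable def homDim (X Y : FGModuleCat.{u} A) : ℤ := Module.finrank k (X →ₗ[A] Y)

theorem homDim_nonneg (X Y : FGModuleCat.{u} A) : 0 ≤ homDim k X Y := Nat.cast_nonneg _

theorem homDim_congr_left {X X' : FGModuleCat.{u} A} (e : X ≃ₗ[A] X') (Z : FGModuleCat.{u} A) :
    homDim k X Z = homDim k X' Z :=
  congrArg Nat.cast (e.congrLeft Z k).finrank_eq

variable [Module.Finite k A]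

theorem finite_hom (X Y : FGModuleCat.{u} A) : Module.Finite k (X →ₗ[A] Y) := by
  have : Module.Finite k X := Module.Finite.trans A X
  have : Module.Finite k Y := Module.Finite.trans A Y
  exact Module.Finite.of_injective (LinearMap.restrictScalarsₗ k A X Y k)
    (LinearMap.restrictScalars_injective k)

theorem homDim_eq_zero_iff {X Y : FGModuleCat.{u} A} :
    homDim k X Y = 0 ↔ ∀ f : X →ₗ[A] Y, f = 0 := by
  have := finite_hom k X Y
  rw [homDim, Nat.cast_eq_zero, Module.finrank_zero_iff]
  exact ⟨fun h f => Subsingleton.elim _ _, fun h => subsingleton_of_forall_eq 0 h⟩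

theorem homDim_pi {M : FGModuleCat.{u} A} {ι : Type*} [Fintype ι] {X : ι → FGModuleCat.{u} A}
    (e : M ≃ₗ[A] ∀ i, X i) (Z : FGModuleCat.{u} A) : homDim k M Z = ∑ i, homDim k (X i) Z := by
  classical
  have := fun i => finite_hom k (X i) Z
  let E : (∀ i, X i →ₗ[A] Z) ≃ₗ[k] (M →ₗ[A] Z) :=
    LinearMap.lsum A (fun i => (X i : Type u)) k ≪≫ₗ e.symm.congrLeft Z k
  simp only [homDim, ← E.finrank_eq, Module.finrank_pi_fintype, Nat.cast_sum]

theorem finrank_eq_add_of_exact {V₁ V₂ V₃ : Type*} [AddCommGroup V₁] [Module k V₁]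
    [AddCommGroup V₂] [Module k V₂] [AddCommGroup V₃] [Module k V₃] [Module.Finite k V₂]
    {f : V₁ →ₗ[k] V₂} {g : V₂ →ₗ[k] V₃} (h : IsShortExact f g) :
    Module.finrank k V₂ = Module.finrank k V₁ + Module.finrank k V₃ := by
  rw [← g.finrank_range_add_finrank_ker, LinearMap.range_eq_top.2 h.surjective, finrank_top,
    h.exact.linearMap_ker_eq, LinearMap.finrank_range_of_inj h.injective, add_comm]

theorem isAdditive_homDim (P : FGModuleCat.{u} A) [Module.Projective A P] :
    IsAdditive (homDim k P) := by
  intro X Y Z i p h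
  have := finite_hom k P Y
  have hcomp : IsShortExact (LinearMap.compRight (M := P) k i) (LinearMap.compRight k p) :=
    ⟨fun f g hfg => (LinearMap.cancel_left h.injective).1 hfg,
      fun f => ⟨fun hf => exists_comp_eq_of_projective h.exact hf, by
        rintro ⟨g, rfl⟩
        exact LinearMap.ext fun x => h.exact.apply_apply_eq_zero (g x)⟩,
      fun f => Module.projective_lifting_property p f h.surjective⟩
  unfold homDim
  exact_mod_cast finrank_eq_add_of_exact k hcomp

theorem homDim_add_of_homSurjective {W Y X Z : FGModuleCat.{u} A} {a : W →ₗ[A] Y} {z : Y →ₗ[A] X}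
    (haz : Function.Exact a z) (hz : Function.Surjective z) (h : HomSurjective a Z) :
    homDim k Y Z = homDim k X Z + homDim k W Z := by
  have := finite_hom k Y Z
  have hcomp : IsShortExact (LinearMap.lcomp k Z z) (LinearMap.lcomp k Z a) :=
    ⟨fun f g hfg => (LinearMap.cancel_right hz).1 hfg,
      fun f => ⟨fun hf => exists_comp_eq_of_exact haz hz f hf, by
        rintro ⟨g, rfl⟩
        exact LinearMap.ext fun x => by simp [haz.apply_apply_eq_zero]⟩,
      h⟩
  unfold homDim
  exact_mod_cast finrank_eq_add_of_exact k hcomp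

theorem exists_isAdditive_eq_homDim {T X : FGModuleCat.{u} A} (h : extPerp (Gen T) X) :
    ∃ G : FGModuleCat.{u} A → ℤ, IsAdditive G ∧ ∀ Z, Gen T Z → homDim k X Z = G Z := by
  have : IsArtinianRing A := IsArtinianRing.of_finite k A
  obtain ⟨P⟩ := nonempty_minimalPresentation X
  have := P.cover₀.projective
  have := P.cover₁.projective
  refine ⟨_, (isAdditive_homDim k P.P₀).sub (isAdditive_homDim k P.P₁), fun Z hZ => ?_⟩
  have hd : HomSurjective P.d Z :=
    (isTorsionClass_homSurjective P.d).gen_le (P.homSurjective h) Z hZ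
  rw [homDim_add_of_homSurjective k P.exact P.cover₀.surjective hd, add_sub_cancel_right]

end HomDim

section DisjointSummands

variable {M N : FGModuleCat.{u} A}

theorem exists_comp_comp_eq_id_of_not_isNilpotent [IsArtinianRing A] {f : Module.End A M}
    (hf : ¬ IsNilpotent f) : ∃ (R : FGModuleCat.{u} A) (a : R →ₗ[A] M) (b : M →ₗ[A] R),
      Nontrivial R ∧ b ∘ₗ f ∘ₗ a = LinearMap.id := by
  obtain ⟨n, hn, hn1⟩ := ((f.eventually_isCompl_ker_pow_range_pow).and
    (Filter.eventually_ge_atTop 1)).exists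
  let R : Submodule A M := LinearMap.range (f ^ n)
  have hfR : ∀ x ∈ R, f x ∈ R := by
    rintro _ ⟨y, rfl⟩
    exact ⟨f y, by rw [← Module.End.mul_apply, ← Module.End.mul_apply, ← pow_succ, ← pow_succ']⟩
  have hinj : Function.Injective (f.restrict hfR) := by
    rw [injective_iff_map_eq_zero]
    intro x hx
    have hker : (x : M) ∈ LinearMap.ker (f ^ n) :=
      Module.End.pow_map_zero_of_le hn1 (by simpa using congrArg Subtype.val hx)
    exact Subtype.ext (Submodule.disjoint_def.1 hn.disjoint x hker x.2)
  obtain ⟨w, hw⟩ : IsUnit (f.restrict hfR) := (Module.End.isUnit_iff _).2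
    ⟨hinj, IsArtinian.surjective_of_injective_endomorphism _ hinj⟩
  refine ⟨FGModuleCat.of A R, R.subtype,
    (↑w⁻¹ : Module.End A R) ∘ₗ Submodule.projectionOnto _ _ hn.symm,
    Submodule.nontrivial_iff_ne_bot.2 fun hR => hf ⟨n, LinearMap.range_eq_bot.1 hR⟩, ?_⟩
  ext x : 1
  have hfx : f (R.subtype x) = (w : Module.End A R) x := by rw [hw]; rfl
  change (↑w⁻¹ : Module.End A R) (Submodule.projectionOnto _ _ hn.symm (f (R.subtype x))) = x
  rw [hfx, Submodule.projectionOnto_apply_left hn.symm, ← Module.End.mul_apply, w.inv_mul]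
  rfl

theorem isNilpotent_of_factorsThrough [IsArtinianRing A]
    (h : ∀ X : FGModuleCat.{u} A, IsIndecomposable X → addClosure M X → ¬ addClosure N X)
    {f : Module.End A M} (hf : FactorsThrough N f) : IsNilpotent f := by
  by_contra hnil
  obtain ⟨R, a, b, _, hba⟩ := exists_comp_comp_eq_id_of_not_isNilpotent hnil
  have hRM : addClosure M R := addClosure_of_isDirectSummand ⟨a, b ∘ₗ f, hba⟩
  have hRN : addClosure N R := addClosure_iff_factorsThrough_id.2 <| by
    rw [← hba]
    exact (hf.comp_right a).comp_left b
  obtain ⟨X, hX, hXR⟩ := exists_isIndecomposable_addClosure R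
  exact h X hX (hRM.trans hXR) (hRN.trans hXR)

theorem mem_jacobson_of_factorsThrough [IsArtinianRing A]
    (h : ∀ X : FGModuleCat.{u} A, IsIndecomposable X → addClosure M X → ¬ addClosure N X)
    {f : Module.End A M} (hf : FactorsThrough N f) : f ∈ Ring.jacobson (Module.End A M) := by
  rw [← Ideal.jacobson_bot, Ideal.mem_jacobson_iff]
  intro y
  obtain ⟨z, hz⟩ := (isNilpotent_of_factorsThrough h (f := y * f) (hf.comp_left y)).isUnit_one_add
  refine ⟨(↑z⁻¹ : Module.End A M), ?_⟩
  have hinv : (↑z⁻¹ : Module.End A M) * y * f + ↑z⁻¹ - 1 = ↑z⁻¹ * (1 + y * f) - 1 := by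
    noncomm_ring
  rw [hinv, ← hz, Units.inv_mul, sub_self]
  exact Submodule.zero_mem _

attribute [local instance] scalarModule isScalarTower_scalarModule

/- Every endomorphism of `M` that factors through `N` is radical, and generation in both directions
says that these endomorphisms already cover `M`; now apply Nakayama's lemma over `End M`. -/
theorem subsingleton_of_gen (k : Type v) [Field k] [Algebra k A] [Module.Finite k A]
    (hM : Gen N M) (hN : Gen M N)
    (h : ∀ X : FGModuleCat.{u} A, IsIndecomposable X → addClosure M X → ¬ addClosure N X) :
    Subsingleton M := by
  classical
  have : IsArtinianRing A := IsArtinianRing.of_finite k A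
  have : Module.Finite k M := Module.Finite.trans A M
  have : Module.Finite (Module.End A M) M :=
    Module.Finite.of_restrictScalars_finite k (Module.End A M) M
  obtain ⟨n, s, hs⟩ := hM
  obtain ⟨m, t, ht⟩ := hN.trans (gen_of_addClosure (addClosure_pi n))
  have htop : (⊤ : Submodule (Module.End A M) M) ≤
      Ring.jacobson (Module.End A M) • (⊤ : Submodule (Module.End A M) M) := by
    rintro x -
    obtain ⟨v, rfl⟩ := (hs.comp ht) x
    rw [Function.comp_apply, ← Finset.univ_sum_single v, map_sum, map_sum]
    refine Submodule.sum_mem _ fun j _ => ?_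
    have hfac : FactorsThrough N (s ∘ₗ t ∘ₗ LinearMap.single A (fun _ : Fin m => (M : Type u)) j) :=
      ((factorsThrough_id_pi n).comp_right (t ∘ₗ LinearMap.single A _ j)).comp_left s
    exact Submodule.smul_mem_smul (mem_jacobson_of_factorsThrough h hfac)
      (Submodule.mem_top (x := v j))
  have := Submodule.FG.eq_bot_of_le_jacobson_smul Module.Finite.fg_top htop
  exact (Submodule.subsingleton_iff (Module.End A M)).1 (subsingleton_of_bot_eq_top this.symm)

end DisjointSummands

/-! ### Counting indecomposable summands -/

section Counting

variable {T : FGModuleCat.{u} A} {ι : Type} {X : ι → FGModuleCat.{u} A}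

/-- The direct sum of the modules `X i` with `i ∈ s`. -/
abbrev partialSum {ι : Type} (X : ι → FGModuleCat.{u} A) (s : Finset ι) : FGModuleCat.{u} A :=
  FGModuleCat.of A (∀ i : s, (X i : Type u))

theorem addClosure_partialSum (h : ∀ i, addClosure T (X i)) (s : Finset ι) :
    addClosure T (partialSum X s) :=
  addClosure_of_equiv_pi (X := fun i : s => X i) (LinearEquiv.refl A (partialSum X s)) fun i => h i

variable (k : Type v) [Field k] [Algebra k A] [Module.Finite k A]

theorem homPerp_partialSum_iff {s : Finset ι} {Z : FGModuleCat.{u} A} :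
    homPerp (partialSum X s) Z ↔ ∀ i ∈ s, homDim k (X i) Z = 0 := by
  rw [homPerp, ← homDim_eq_zero_iff k, homDim_pi k (X := fun i : s => X i)
    (LinearEquiv.refl A (partialSum X s)), Finset.sum_eq_zero_iff_of_nonneg fun i _ =>
    homDim_nonneg k _ _]
  simp

theorem gen_of_forall_homPerp [IsNoetherianRing A] (hT : extPerp (Gen T) T)
    {U V : FGModuleCat.{u} A} (hU : addClosure T U) (hV : addClosure T V)
    (h : ∀ Z, Gen T Z → homPerp U Z → homPerp V Z) : Gen U V :=
  gen_of_forall_eq_zero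
    ((hT _ ((gen_of_addClosure hU).trans (gen_trace U V))).of_addClosure hU)
    fun Y hY => h Y ((gen_of_addClosure hV).trans hY)

namespace IsSummandSystem

include k in
theorem eq_empty_of_disjoint (hX : IsSummandSystem X T) (hT : extPerp (Gen T) T)
    {s t : Finset ι} (hst : Disjoint s t)
    (h : ∀ Z, Gen T Z → (homPerp (partialSum X s) Z ↔ homPerp (partialSum X t) Z)) : s = ∅ := by
  have : IsArtinianRing A := IsArtinianRing.of_finite k A
  have hs := addClosure_partialSum hX.addClosure s
  have ht := addClosure_partialSum hX.addClosure t
  have hsub : Subsingleton (partialSum X s) := by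
    refine subsingleton_of_gen k (gen_of_forall_homPerp hT ht hs fun Z hZ => (h Z hZ).2)
      (gen_of_forall_homPerp hT hs ht fun Z hZ => (h Z hZ).1) fun Y hY hYs hYt => ?_
    obtain ⟨⟨a, ha⟩, ⟨e⟩⟩ := hY.exists_equiv (Y := fun i : s => X i)
      (fun i => hX.isIndecomposable i) (LinearEquiv.refl A (partialSum X s)) hYs
    obtain ⟨⟨b, hb⟩, ⟨f⟩⟩ := hY.exists_equiv (Y := fun i : t => X i)
      (fun i => hX.isIndecomposable i) (LinearEquiv.refl A (partialSum X t)) hYt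
    exact Finset.disjoint_left.1 hst ha (hX.eq_of_equiv a b ⟨e.symm ≪≫ₗ f⟩ ▸ hb)
  classical
  by_contra hne
  obtain ⟨j, hj⟩ := Finset.nonempty_iff_ne_empty.2 hne
  obtain ⟨x, hx⟩ := (nontrivial_iff_exists_ne 0).1 (hX.isIndecomposable j).1
  have hsingle : (Pi.single ⟨j, hj⟩ x : ∀ i : s, (X i : Type u)) = 0 := Subsingleton.elim _ _
  exact hx (by simpa using congrFun hsingle ⟨j, hj⟩)

end IsSummandSystem

theorem eq_zero_of_sum_mul_eq_zero {ι : Type*} [Fintype ι] {c d : ι → ℤ} (hd : ∀ i, 0 ≤ d i)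
    (h : ∑ i, c i * d i = 0) (hpos : ∀ i, 0 < c i → d i = 0) {i : ι} (hi : c i < 0) : d i = 0 := by
  have hterm : ∀ i ∈ Finset.univ, c i * d i ≤ 0 := fun i _ => by
    rcases lt_or_ge 0 (c i) with hi | hi
    · rw [hpos i hi, mul_zero]
    · exact mul_nonpos_of_nonpos_of_nonneg hi (hd i)
  have := (Finset.sum_eq_zero_iff_of_nonpos hterm).1 h i (Finset.mem_univ i)
  exact (mul_eq_zero.1 this).resolve_left hi.ne

namespace IsSummandSystem

variable [Fintype ι]

theorem nonpos_of_sum_homDim_eq_zero (hX : IsSummandSystem X T) (hT : extPerp (Gen T) T)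
    {c : ι → ℤ} (hc : ∀ Z, Gen T Z → ∑ i, c i * homDim k (X i) Z = 0) (j : ι) : c j ≤ 0 := by
  suffices h : Finset.univ.filter (0 < c ·) = ∅ by
    exact not_lt.1 (Finset.filter_eq_empty_iff.1 h (Finset.mem_univ j))
  refine hX.eq_empty_of_disjoint k hT (t := Finset.univ.filter (c · < 0))
    (Finset.disjoint_filter.2 fun i _ h h' => h.not_gt h') fun Z hZ => ?_
  simp only [homPerp_partialSum_iff k, Finset.mem_filter_univ]
  exact ⟨fun h i => eq_zero_of_sum_mul_eq_zero (fun i => homDim_nonneg k _ _) (hc Z hZ) h,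
    fun h i hi => eq_zero_of_sum_mul_eq_zero (c := -c) (fun i => homDim_nonneg k _ _)
      (by simpa using hc Z hZ) (by simpa using h) (by simpa using hi)⟩

theorem eq_zero_of_sum_homDim_eq_zero (hX : IsSummandSystem X T) (hT : extPerp (Gen T) T)
    {c : ι → ℤ} (hc : ∀ Z, Gen T Z → ∑ i, c i * homDim k (X i) Z = 0) (j : ι) : c j = 0 :=
  le_antisymm (hX.nonpos_of_sum_homDim_eq_zero k hT hc j) <| by
    simpa using hX.nonpos_of_sum_homDim_eq_zero k hT (c := -c)
      (fun Z hZ => by simpa using hc Z hZ) j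

theorem exists_homDim_eq_sum (hX : IsSummandSystem X T) {L : FGModuleCat.{u} A}
    (hL : WeakCotorsion.addClosure T L) :
    ∃ c : ι → ℤ, ∀ Z, homDim k L Z = ∑ j, c j * homDim k (X j) Z := by
  classical
  have : IsArtinianRing A := IsArtinianRing.of_finite k A
  obtain ⟨κ, _, Y, hY, ⟨e⟩⟩ := exists_indecomposable_decomposition L
  choose σ hσ using fun i =>
    hX.exists_equiv (Y i) (hY i) (hL.trans (addClosure_apply_of_equiv_pi e i))
  refine ⟨fun j => ∑ i, if σ i = j then 1 else 0, fun Z => ?_⟩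
  simp only [homDim_pi k e, Finset.sum_mul]
  rw [Finset.sum_comm]
  refine Finset.sum_congr rfl fun i _ => ?_
  simp [homDim_congr_left k (hσ i).some Z]

end IsSummandSystem

include k in
theorem numIndecomposableSummands_le_numSimples (hT : extPerp (Gen T) T) :
    numIndecomposableSummands T ≤ numSimples A := by
  have : IsArtinianRing A := IsArtinianRing.of_finite k A
  obtain ⟨m, X, hX⟩ := exists_isSummandSystem T
  rw [hX.numIndecomposableSummands_eq, numSimples]
  set 𝒮 := {c : IsoClass A | ∃ S : FGModuleCat.{u} A, isoClass S = c ∧ IsSimpleModule A S}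
  rcases 𝒮.finite_or_infinite with hfin | hinf
  swap
  · rw [hinf.encard_eq]
    exact le_top
  have := hfin.fintype
  choose S hS _ using fun c : 𝒮 => c.2
  choose G hG hGX using fun j => exists_isAdditive_eq_homDim k (extPerp_addClosure hT
    (hX.addClosure j))
  have hli : LinearIndependent ℤ fun (j : Fin m) (c : 𝒮) => G j (S c) := by
    rw [Fintype.linearIndependent_iff]
    intro c hc
    refine hX.eq_zero_of_sum_homDim_eq_zero k hT fun Z hZ => ?_
    simp only [fun j => hGX j Z hZ]
    refine (IsAdditive.sum_mul Finset.univ c hG).eq_zero (fun S' hS' => ?_) Z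
    obtain ⟨e⟩ := isoClass_eq_iff.1 (hS ⟨isoClass S', S', rfl, hS'⟩)
    simpa [fun j => (hG j).congr e] using congrFun hc ⟨isoClass S', S', rfl, hS'⟩
  have := hli.fintype_card_le_finrank
  rw [Module.finrank_fintype_fun_eq_card] at this
  rw [Set.encard_eq_coe_toFinset_card, Set.toFinset_card]
  exact_mod_cast this

end Counting

section ProjectiveCoversOfSimples

theorem IsProjectiveCover.nonempty_equiv {P S S' : FGModuleCat.{u} A} {π : P →ₗ[A] S}
    (hπ : IsProjectiveCover π) (hS : IsSimpleModule A S) (hS' : IsSimpleModule A S')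
    {f : P →ₗ[A] S'} (hf : f ≠ 0) : Nonempty (S ≃ₗ[A] S') := by
  have hcoatom : IsCoatom (LinearMap.ker f) :=
    LinearMap.isCoatom_ker_of_surjective (LinearMap.surjective_of_ne_zero hf)
  have hle : LinearMap.ker π ≤ LinearMap.ker f := by
    by_contra hle
    exact hcoatom.1 (hπ.superfluous _ (hcoatom.2 _ (left_lt_sup.2 hle)))
  obtain ⟨g, rfl⟩ := exists_comp_eq_of_exact (isShortExact_subtype_ker hπ.surjective).exact
    hπ.surjective f (LinearMap.ext fun x => hle x.2)
  have hg : g ≠ 0 := by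
    rintro rfl
    exact hf (LinearMap.zero_comp π)
  exact ⟨LinearEquiv.ofBijective g (LinearMap.bijective_of_ne_zero hg)⟩

variable (k : Type v) [Field k] [Algebra k A] [Module.Finite k A]

theorem linearIndependent_homDim_of_isProjectiveCover {ι : Type*} {S P : ι → FGModuleCat.{u} A}
    {π : ∀ i, P i →ₗ[A] S i} (hπ : ∀ i, IsProjectiveCover (π i))
    (hS : ∀ i, IsSimpleModule A (S i)) (hSi : ∀ i j, Nonempty (S i ≃ₗ[A] S j) → i = j) :
    LinearIndependent ℤ fun i j => homDim k (P i) (S j) := by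
  have hoff : ∀ i j, i ≠ j → homDim k (P i) (S j) = 0 := fun i j hij => by
    rw [homDim_eq_zero_iff]
    intro f
    by_contra hf
    exact hij (hSi i j ((hπ i).nonempty_equiv (hS i) (hS j) hf))
  have hdiag : ∀ i, homDim k (P i) (S i) ≠ 0 := fun i h => by
    have := (hS i).nontrivial
    obtain ⟨x, hx⟩ := exists_ne (0 : S i)
    obtain ⟨y, rfl⟩ := (hπ i).surjective x
    exact hx (by rw [(homDim_eq_zero_iff k).1 h (π i), LinearMap.zero_apply])
  rw [linearIndependent_iff']
  intro s a ha i hi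
  have hsum := congrFun ha i
  simp only [Finset.sum_apply, Pi.smul_apply, smul_eq_mul, Pi.zero_apply] at hsum
  rw [Finset.sum_eq_single i (fun j _ hj => by rw [hoff j i hj, mul_zero])
    fun h => absurd hi h] at hsum
  exact (mul_eq_zero.1 hsum).resolve_right (hdiag i)

end ProjectiveCoversOfSimples

section SiltingCounting

theorem IsAdditive.eq_zero_of_forall_gen {F : FGModuleCat.{u} A → ℤ} (hF : IsAdditive F)
    {T S Z : FGModuleCat.{u} A} (h : ∀ Z, Gen T Z → F Z = 0) (hZ : Gen T Z) {i : S →ₗ[A] Z}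
    (hi : Function.Injective i) : F S = 0 := by
  have hseq := hF (Z := FGModuleCat.of A (Z ⧸ LinearMap.range i))
    (p := (LinearMap.range i).mkQ)
    ⟨hi, LinearMap.exact_map_mkQ_range i, Submodule.mkQ_surjective _⟩
  have hquot : F (FGModuleCat.of A (Z ⧸ LinearMap.range i)) = 0 :=
    h _ (hZ.of_surjective (Submodule.mkQ_surjective _))
  rw [h Z hZ, hquot, add_zero] at hseq
  exact hseq.symm

variable (k : Type v) [Field k] [Algebra k A] [Module.Finite k A] {T : FGModuleCat.{u} A}

theorem IsSilting.exists_homDim_eq_sum (hT : IsSilting T) {ι : Type} [Fintype ι]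
    {X : ι → FGModuleCat.{u} A} (hX : IsSummandSystem X T) (P : FGModuleCat.{u} A)
    [Module.Projective A P] :
    ∃ c : ι → ℤ, ∀ Z, Gen T Z → homDim k P Z = ∑ j, c j * homDim k (X j) Z := by
  have : IsArtinianRing A := IsArtinianRing.of_finite k A
  have h𝒯 := isTorsionClass_gen hT.ext
  obtain ⟨Y, V, g, p, -, hV, hs⟩ := hT.exists_approxSequence
  obtain ⟨n, L, l, q, hl, -⟩ := hs.exists_of_finite h𝒯 P
  have hLT : addClosure T L := by
    rw [hT.addClosure_eq]
    exact ⟨hl.extPerp_middle h𝒯, hl.mem⟩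
  obtain ⟨a, ha⟩ := hX.exists_homDim_eq_sum k hLT
  obtain ⟨b, hb⟩ := hX.exists_homDim_eq_sum k (hV.trans (addClosure_pi n))
  refine ⟨a - b, fun Z hZ => ?_⟩
  have hLP := homDim_add_of_homSurjective k hl.exact hl.surjective (hl.approx Z hZ)
  simp only [Pi.sub_apply, sub_mul, Finset.sum_sub_distrib, ← ha, ← hb, hLP]
  ring

include k in
theorem IsSilting.numSimples_le (hT : IsSilting T)
    (h : ∀ S : FGModuleCat.{u} A, IsSimpleModule A S →
      ∃ (Z : FGModuleCat.{u} A) (i : S →ₗ[A] Z), Gen T Z ∧ Function.Injective i) :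
    numSimples A ≤ numIndecomposableSummands T := by
  classical
  have : IsArtinianRing A := IsArtinianRing.of_finite k A
  obtain ⟨m, X, hX⟩ := exists_isSummandSystem T
  rw [hX.numIndecomposableSummands_eq, Fintype.card_fin, numSimples]
  set 𝒮 := {c : IsoClass A | ∃ S : FGModuleCat.{u} A, isoClass S = c ∧ IsSimpleModule A S}
  choose S hS hSs using fun c : 𝒮 => c.2
  choose P π hπ using fun c => exists_projectiveCover (S c)
  choose G hG hGX using fun j => exists_isAdditive_eq_homDim k (extPerp_addClosure hT.ext
    (hX.addClosure j))
  have hli := linearIndependent_homDim_of_isProjectiveCover k hπ hSs fun c c' e =>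
    Subtype.ext (by rw [← hS c, ← hS c']; exact isoClass_eq_iff.2 e)
  have hspan : Set.range (fun (c c' : 𝒮) => homDim k (P c) (S c')) ⊆
      Submodule.span ℤ (Set.range fun (j : Fin m) (c' : 𝒮) => G j (S c')) := by
    rintro _ ⟨c, rfl⟩
    have := (hπ c).projective
    obtain ⟨a, ha⟩ := hT.exists_homDim_eq_sum k hX (P c)
    have hzero : ∀ Z, Gen T Z → homDim k (P c) Z - ∑ j, a j * G j Z = 0 := fun Z hZ => by
      simp only [ha Z hZ, fun j => hGX j Z hZ, sub_self]
    have hrow : (fun c' : 𝒮 => homDim k (P c) (S c')) =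
        ∑ j, a j • fun c' : 𝒮 => G j (S c') := by
      ext c'
      obtain ⟨Z, i, hZ, hi⟩ := h (S c') (hSs c')
      have hS' := ((isAdditive_homDim k (P c)).sub
        (IsAdditive.sum_mul _ a hG)).eq_zero_of_forall_gen hzero hZ hi
      simpa using sub_eq_zero.1 hS'
    rw [SetLike.mem_coe]
    beta_reduce
    rw [hrow]
    exact Submodule.sum_mem _ fun j _ => Submodule.smul_mem _ _ (Submodule.subset_span ⟨j, rfl⟩)
  have hcard := linearIndependent_le_span' _ hli _ hspan
  refine Cardinal.toENat_le_natCast.2 (hcard.trans (Nat.cast_le.2 ?_))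
  simpa using Fintype.card_range_le fun (j : Fin m) (c' : 𝒮) => G j (S c')

end SiltingCounting

/-! ### Silting modules and `τ`-tilting modules -/

section Completion

variable (k : Type v) [Field k] [Algebra k A]

attribute [local instance] scalarModule isScalarTower_scalarModule

-- The scalars `c i` act on `P` and `Q` by module maps commuting with `d`.
theorem exists_comp_eq_inr_comp {P Q L : FGModuleCat.{u} A} {r : ℕ} {φ : Fin r → P →ₗ[A] L}
    (hφ : Submodule.span k (Set.range φ) = ⊤) (d : P →ₗ[A] Q) (f : P →ₗ[A] L) :
    ∃ g : Q →ₗ[A] PushoutModule (d.compLeft (Fin r)) (LinearMap.lsum A (fun _ => P) ℕ φ),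
      g ∘ₗ d = PushoutModule.inr _ _ ∘ₗ f := by
  obtain ⟨c, rfl⟩ := (Submodule.mem_span_range_iff_exists_fun k).1 (hφ ▸ Submodule.mem_top (x := f))
  let scale (X : FGModuleCat.{u} A) : X →ₗ[A] Fin r → X := LinearMap.pi fun i => c i • LinearMap.id
  have hd : d.compLeft (Fin r) ∘ₗ scale P = scale Q ∘ₗ d := by
    ext x i
    simp [scale]
  have hl : LinearMap.lsum A (fun _ => P) ℕ φ ∘ₗ scale P = ∑ i, c i • φ i := by
    ext x
    simp [scale]
  refine ⟨PushoutModule.inl _ _ ∘ₗ scale Q, ?_⟩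
  rw [LinearMap.comp_assoc, ← hd, ← LinearMap.comp_assoc, PushoutModule.inl_comp,
    LinearMap.comp_assoc, hl]

variable [Module.Finite k A]

include k in
theorem HomSurjective.exists_isApproxSequence {P₁ P₀ T : FGModuleCat.{u} A}
    [Module.Projective A P₁] [Module.Projective A P₀] {d : P₁ →ₗ[A] P₀} {π : P₀ →ₗ[A] T}
    (hT : HomSurjective d T) (hdπ : Function.Exact d π) (hπ : Function.Surjective π)
    (L : FGModuleCat.{u} A) :
    ∃ (r : ℕ) (E : FGModuleCat.{u} A) (j : L →ₗ[A] E) (q : E →ₗ[A] (Fin r → T)),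
      IsApproxSequence (fun X : FGModuleCat.{u} A => HomSurjective d X)
        (X := FGModuleCat.of A (Fin r → T)) j q := by
  have : IsArtinianRing A := IsArtinianRing.of_finite k A
  have := finite_hom k P₁ L
  obtain ⟨r, φ, hφ⟩ := Module.Finite.exists_fin (R := k) (M := P₁ →ₗ[A] L)
  have hr := exact_compLeft hdπ r
  have hexact := PushoutModule.exact_inr_desc (LinearMap.lsum A (fun _ => P₁) ℕ φ) hr
  have hsurj := PushoutModule.desc_surjective_left (hr.linearMap_comp_eq_zero.trans
    (LinearMap.zero_comp (LinearMap.lsum A (fun _ => P₁) ℕ φ)).symm) hπ.comp_left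
  refine ⟨r, FGModuleCat.of A (PushoutModule (d.compLeft (Fin r)) _), _, _, hexact, hsurj, ?_,
    extPerp_addClosure (fun Y hY => hY.extOneVanishes hdπ hπ) (addClosure_pi r), fun Z hZ h => ?_⟩
  · exact ((isTorsionClass_homSurjective d).pi hT r).of_exact hexact hsurj
      (exists_comp_eq_inr_comp k hφ d)
  · choose t ht using fun i => hZ (h ∘ₗ φ i)
    refine ⟨PushoutModule.desc (LinearMap.lsum A (fun _ => P₀) ℕ t) h
      (LinearMap.pi_ext' fun i => ?_), PushoutModule.desc_comp_inr _⟩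
    ext x
    simpa [Pi.single_apply, apply_ite d, apply_ite (t _), apply_ite h, apply_ite (φ _)]
      using LinearMap.congr_fun (ht i) x

include k in
theorem exists_isSilting_addClosure {T : FGModuleCat.{u} A} (hT : extPerp (Gen T) T) :
    ∃ T' : FGModuleCat.{u} A, IsSilting T' ∧ addClosure T' T := by
  have : IsArtinianRing A := IsArtinianRing.of_finite k A
  obtain ⟨P⟩ := nonempty_minimalPresentation T
  have := P.cover₀.projective
  have := P.cover₁.projective
  have hdT := P.homSurjective hT
  obtain ⟨r, E, j, q, hs⟩ := hdT.exists_isApproxSequence k P.exact P.cover₀.surjective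
    (FGModuleCat.of A A)
  have h𝒯 := isTorsionClass_homSurjective P.d
  have hadd := hs.addClosure_prod_eq h𝒯
  exact ⟨_, hs.isSilting h𝒯 hadd,
    hadd ▸ ⟨fun Y hY => hY.extOneVanishes P.exact P.cover₀.surjective, hdT⟩⟩

end Completion

section TauTilting

variable {T T' : FGModuleCat.{u} A}

theorem IsSilting.of_addClosure_eq [IsNoetherianRing A] (hT : IsSilting T)
    (h : addClosure T' = addClosure T) : IsSilting T' := by
  obtain ⟨Y, X, g, p, -, -, hs⟩ := hT.exists_approxSequence
  exact hs.isSilting (isTorsionClass_gen hT.ext) (h.trans hT.addClosure_eq)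

theorem isSilting_congr [IsNoetherianRing A] (e : T ≃ₗ[A] T') : IsSilting T ↔ IsSilting T' := by
  have h : addClosure T = addClosure T' := le_antisymm
    (addClosure_le (addClosure_of_equiv e.symm)) (addClosure_le (addClosure_of_equiv e))
  exact ⟨fun hT => hT.of_addClosure_eq h.symm, fun hT' => hT'.of_addClosure_eq h⟩

theorem addClosure_of_numIndecomposableSummands_le [IsArtinianRing A] (h : addClosure T' T)
    (hle : numIndecomposableSummands T' ≤ numIndecomposableSummands T) : addClosure T T' := by
  obtain ⟨m, X, hX⟩ := exists_isSummandSystem T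
  obtain ⟨m', X', hX'⟩ := exists_isSummandSystem T'
  rw [hX.numIndecomposableSummands_eq, hX'.numIndecomposableSummands_eq, Nat.cast_le] at hle
  choose σ hσ using fun i =>
    hX'.exists_equiv (X i) (hX.isIndecomposable i) (h.trans (hX.addClosure i))
  have hinj : Function.Injective σ := fun i j hij =>
    hX.eq_of_equiv i j ⟨(hσ i).some ≪≫ₗ (hij ▸ (hσ j).some.symm)⟩
  have hsurj : Function.Surjective σ := ((Fintype.bijective_iff_injective_and_card σ).2
    ⟨hinj, le_antisymm (Fintype.card_le_of_injective σ hinj) hle⟩).2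
  obtain ⟨κ, _, Y, hY, ⟨e⟩⟩ := exists_indecomposable_decomposition T'
  refine addClosure_of_equiv_pi e fun i => ?_
  obtain ⟨j, ⟨f⟩⟩ := hX'.exists_equiv (Y i) (hY i) (addClosure_apply_of_equiv_pi e i)
  obtain ⟨i', rfl⟩ := hsurj j
  exact (hX.addClosure i').trans (addClosure_of_equiv ((hσ i').some ≪≫ₗ f.symm))

theorem IsTauTilting.isSilting {k : Type v} [Field k] [Algebra k A] [Module.Finite k A]
    (hT : IsTauTilting k T) : IsSilting T := by
  have : IsArtinianRing A := IsArtinianRing.of_finite k A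
  obtain ⟨T', hT', hTT'⟩ := exists_isSilting_addClosure k ((forall_hom_tau_eq_zero_iff k T).1 hT.1)
  have hT'T := addClosure_of_numIndecomposableSummands_le hTT'
    (hT.2 ▸ numIndecomposableSummands_le_numSimples k hT'.ext)
  exact hT'.of_addClosure_eq (le_antisymm (addClosure_le hTT') (addClosure_le hT'T))

theorem IsSilting.isTauTilting (k : Type v) [Field k] [Algebra k A] [Module.Finite k A]
    (hT : IsSilting T)
    (h : ∀ S : FGModuleCat.{u} A, IsSimpleModule A S →
      ∃ (Z : FGModuleCat.{u} A) (i : S →ₗ[A] Z), Gen T Z ∧ Function.Injective i) :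
    IsTauTilting k T :=
  ⟨(forall_hom_tau_eq_zero_iff k T).2 hT.ext,
    le_antisymm (numIndecomposableSummands_le_numSimples k hT.ext) (hT.numSimples_le k h)⟩

end TauTilting

/-! ### Support `τ`-tilting modules -/

section Restriction

variable (I : Ideal A) [I.IsTwoSided]

/-- The restriction of scalars of an `A ⧸ I`-module to `A`, with the same underlying type. -/
def res (X : FGModuleCat.{u} (A ⧸ I)) : FGModuleCat.{u} A :=
  letI : Module A X := Module.compHom X (Ideal.Quotient.mk I)
  haveI : IsScalarTower A (A ⧸ I) X := ⟨fun a b x => mul_smul (Ideal.Quotient.mk I a) b x⟩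
  haveI : Module.Finite A X := Module.Finite.trans (A ⧸ I) X
  FGModuleCat.of A X

variable {I}

/-- The action of restriction of scalars on module maps. -/
def resMap {X Y : FGModuleCat.{u} (A ⧸ I)} (f : X →ₗ[A ⧸ I] Y) : res I X →ₗ[A] res I Y where
  toFun := f
  map_add' := f.map_add
  map_smul' a x := f.map_smul (Ideal.Quotient.mk I a) x

/-- The inverse of `resMap`: restriction of scalars along the surjection `A → A ⧸ I` is full. -/
def unresMap {X Y : FGModuleCat.{u} (A ⧸ I)} (f : res I X →ₗ[A] res I Y) : X →ₗ[A ⧸ I] Y where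
  toFun := f
  map_add' := f.map_add
  map_smul' b x := by
    obtain ⟨a, rfl⟩ := Ideal.Quotient.mk_surjective b
    exact f.map_smul a x

variable {M Z : FGModuleCat.{u} A} {N X Y S : FGModuleCat.{u} (A ⧸ I)}

theorem smul_res_eq_zero {a : A} (ha : a ∈ I) (x : res I X) : a • x = 0 := by
  change (Ideal.Quotient.mk I a • (show X from x) : X) = 0
  rw [Ideal.Quotient.eq_zero_iff_mem.2 ha, zero_smul]

theorem exists_equiv_res (hM : ∀ a ∈ I, ∀ m : M, a • m = 0) :
    ∃ X : FGModuleCat.{u} (A ⧸ I), Nonempty (M ≃ₗ[A] res I X) := by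
  have hM' : Module.IsTorsionBySet A M I := fun m a => hM a a.2 m
  let _ : Module (A ⧸ I) M := hM'.module
  have : Module.Finite (A ⧸ I) M := Module.Finite.of_surjective hM'.semilinearMap fun m => ⟨m, rfl⟩
  let f : M →ₗ[A] res I (FGModuleCat.of (A ⧸ I) M) :=
    { toFun := id
      map_add' := fun _ _ => rfl
      map_smul' := fun _ _ => rfl }
  exact ⟨FGModuleCat.of (A ⧸ I) M, ⟨LinearEquiv.ofBijective f Function.bijective_id⟩⟩

theorem addClosure_res_iff : addClosure (res I N) (res I X) ↔ addClosure N X :=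
  ⟨fun ⟨n, i, r, h⟩ => ⟨n, unresMap (Y := FGModuleCat.of (A ⧸ I) (Fin n → N)) i,
      unresMap (X := FGModuleCat.of (A ⧸ I) (Fin n → N)) r,
      LinearMap.ext fun x => LinearMap.congr_fun h x⟩,
    fun ⟨n, i, r, h⟩ => ⟨n, resMap (Y := FGModuleCat.of (A ⧸ I) (Fin n → N)) i,
      resMap (X := FGModuleCat.of (A ⧸ I) (Fin n → N)) r,
      LinearMap.ext fun x => LinearMap.congr_fun h x⟩⟩

theorem gen_res_iff : Gen (res I N) (res I X) ↔ Gen N X :=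
  ⟨fun ⟨n, f, hf⟩ => ⟨n, unresMap (X := FGModuleCat.of (A ⧸ I) (Fin n → N)) f, hf⟩,
    fun ⟨n, f, hf⟩ => ⟨n, resMap (X := FGModuleCat.of (A ⧸ I) (Fin n → N)) f, hf⟩⟩

theorem Gen.exists_equiv_res (hZ : Gen (res I N) Z) :
    ∃ Z' : FGModuleCat.{u} (A ⧸ I), Gen N Z' ∧ Nonempty (Z ≃ₗ[A] res I Z') := by
  have hkill : ∀ a ∈ I, ∀ z : Z, a • z = 0 := by
    intro a ha z
    obtain ⟨n, f, hf⟩ := hZ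
    obtain ⟨x, rfl⟩ := hf z
    have hx : a • x = 0 := funext fun i => smul_res_eq_zero ha (x i)
    rw [← map_smul, hx, map_zero]
  obtain ⟨Z', ⟨e⟩⟩ := WeakCotorsion.exists_equiv_res hkill
  exact ⟨Z', gen_res_iff.1 (hZ.of_surjective e.surjective), ⟨e⟩⟩

theorem isSimpleModule_res (hS : IsSimpleModule (A ⧸ I) S) : IsSimpleModule A (res I S) := by
  rw [isSimpleModule_iff_toSpanSingleton_surjective] at *
  exact ⟨hS.1, fun x hx => (hS.2 x hx).comp Ideal.Quotient.mk_surjective⟩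

theorem exact_toSpanSingleton_resMap_iff {y : Y} {p : Y →ₗ[A ⧸ I] X} :
    Function.Exact (LinearMap.toSpanSingleton A (res I Y) y) (resMap p) ↔
      Function.Exact (LinearMap.toSpanSingleton (A ⧸ I) Y y) p :=
  forall_congr' fun x => iff_congr Iff.rfl
    ((Ideal.Quotient.mk_surjective (I := I)).exists (p := fun b => b • y = x)).symm

-- If `a, b ∈ I`, then `b` maps the middle term of an extension into the kernel and `a` kills it.
theorem smul_eq_zero_of_exact (hI : IsIdempotentElem I) {i : res I Y →ₗ[A] M}
    {p : M →ₗ[A] res I X} (hip : Function.Exact i p) {a : A} (ha : a ∈ I) (m : M) :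
    a • m = 0 := by
  rw [← hI.eq] at ha
  induction ha using Submodule.mul_induction_on' with
  | mem_mul_mem a ha b hb =>
    obtain ⟨y, hy⟩ := (hip (b • m)).1 (by rw [map_smul, smul_res_eq_zero hb])
    rw [mul_smul, ← hy, ← map_smul, smul_res_eq_zero ha, map_zero]
  | add a _ b _ iha ihb => rw [add_smul, iha, ihb, add_zero]

variable [IsNoetherianRing A]

theorem extOneVanishes_res_iff (hI : IsIdempotentElem I) :
    ExtOneVanishes (res I X) (res I Y) ↔ ExtOneVanishes X Y := by
  have : IsNoetherianRing (A ⧸ I) :=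
    isNoetherianRing_of_surjective A (A ⧸ I) (Ideal.Quotient.mk I) Ideal.Quotient.mk_surjective
  constructor <;> refine fun h => extOneVanishes_of_forall_exists_section fun E i p hip => ?_
  · obtain ⟨s, hs⟩ := h.exists_lift (i := resMap i) (p := resMap p)
      ⟨hip.injective, hip.exact, hip.surjective⟩ LinearMap.id
    exact ⟨unresMap s, LinearMap.ext fun x => LinearMap.congr_fun hs x⟩
  · obtain ⟨E', ⟨f⟩⟩ := exists_equiv_res fun a ha => smul_eq_zero_of_exact hI hip.exact ha
    have hip' : IsShortExact (f.toLinearMap ∘ₗ i) (p ∘ₗ f.symm.toLinearMap) :=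
      ⟨f.injective.comp hip.injective, hip.exact.of_ladder_linearEquiv_of_exact
        (e₁ := LinearEquiv.refl A _) (e₂ := f) (e₃ := LinearEquiv.refl A _) rfl (by ext; simp),
        hip.surjective.comp f.symm.surjective⟩
    obtain ⟨s, hs⟩ := h.exists_lift (i := unresMap (f.toLinearMap ∘ₗ i))
      (p := unresMap (p ∘ₗ f.symm.toLinearMap))
      ⟨hip'.injective, hip'.exact, hip'.surjective⟩ LinearMap.id
    exact ⟨f.symm.toLinearMap ∘ₗ resMap s, LinearMap.ext fun x => LinearMap.congr_fun hs x⟩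

theorem isApproxSequence_res_iff (hI : IsIdempotentElem I) {y : Y} {p : Y →ₗ[A ⧸ I] X} :
    IsApproxSequence (Gen (res I N)) (LinearMap.toSpanSingleton A (res I Y) y) (resMap p) ↔
      IsApproxSequence (Gen N) (LinearMap.toSpanSingleton (A ⧸ I) Y y) p := by
  refine ⟨fun hs => ⟨exact_toSpanSingleton_resMap_iff.1 hs.exact, hs.surjective,
    gen_res_iff.1 hs.mem, fun Z hZ => ?_, fun Z hZ h => ?_⟩,
    fun hs => ⟨exact_toSpanSingleton_resMap_iff.2 hs.exact, hs.surjective,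
      gen_res_iff.2 hs.mem, fun Z hZ => ?_, fun Z hZ h => ?_⟩⟩
  · exact (extOneVanishes_res_iff hI).1 (hs.ext _ (gen_res_iff.2 hZ))
  · obtain ⟨c, hc⟩ := hs.approx (res I Z) (gen_res_iff.2 hZ)
      (LinearMap.toSpanSingleton A (res I Z) (h 1))
    have hcy : c y = h 1 := (congrArg c (one_smul A (show res I Y from y))).symm.trans
      ((LinearMap.congr_fun hc 1).trans (one_smul A (show res I Z from h 1)))
    exact ⟨unresMap c, LinearMap.ext_ring ((congrArg c (one_smul (A ⧸ I) y)).trans hcy)⟩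
  · obtain ⟨Z', hZ', ⟨f⟩⟩ := hZ.exists_equiv_res
    exact ((extOneVanishes_res_iff hI).2 (hs.ext Z' hZ')).congr_right f.symm
  · obtain ⟨Z', hZ', ⟨f⟩⟩ := hZ.exists_equiv_res
    obtain ⟨c, hc⟩ := hs.approx Z' hZ' (LinearMap.toSpanSingleton (A ⧸ I) Z' (f (h 1)))
    have hcy : c y = f (h 1) := (congrArg c (one_smul (A ⧸ I) y)).symm.trans
      ((LinearMap.congr_fun hc 1).trans (one_smul (A ⧸ I) _))
    refine ⟨f.symm.toLinearMap ∘ₗ resMap c, LinearMap.ext_ring ?_⟩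
    exact (congrArg (f.symm ∘ resMap c) (one_smul A (show res I Y from y))).trans
      (f.symm_apply_eq.2 hcy)

theorem isSilting_res_iff (hI : IsIdempotentElem I) : IsSilting (res I N) ↔ IsSilting N := by
  constructor
  · intro hN
    obtain ⟨Y, X, g, p, hY, hX, hs⟩ := hN.exists_approxSequence
    obtain ⟨Y', -, ⟨eY⟩⟩ := (gen_of_addClosure hY).exists_equiv_res
    obtain ⟨X', -, ⟨eX⟩⟩ := (gen_of_addClosure hX).exists_equiv_res
    have hs' := hs.congr (isTorsionClass_gen hN.ext) eY eX
    have hg : eY.toLinearMap ∘ₗ g = LinearMap.toSpanSingleton A (res I Y') (eY (g 1)) :=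
      LinearMap.ext_ring (one_smul A _).symm
    rw [hg] at hs'
    exact ⟨fun Z hZ => (extOneVanishes_res_iff hI).1 (hN.ext _ (gen_res_iff.2 hZ)), Y', X', _, _,
      addClosure_res_iff.1 (hY.trans (addClosure_of_equiv eY)),
      addClosure_res_iff.1 (hX.trans (addClosure_of_equiv eX)),
      (isApproxSequence_res_iff hI (y := eY (g 1)) (p := unresMap
        (eX.toLinearMap ∘ₗ p ∘ₗ eY.symm.toLinearMap))).1 hs'⟩
  · intro hN
    obtain ⟨Y, X, g, p, hY, hX, hs⟩ := hN.exists_approxSequence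
    obtain ⟨y, rfl⟩ : ∃ y, LinearMap.toSpanSingleton (A ⧸ I) Y y = g :=
      ⟨g 1, LinearMap.ext_ring (one_smul _ _)⟩
    refine ⟨fun Z hZ => ?_, res I Y, res I X, _, _, addClosure_res_iff.2 hY,
      addClosure_res_iff.2 hX, (isApproxSequence_res_iff hI).2 hs⟩
    obtain ⟨Z', hZ', ⟨f⟩⟩ := hZ.exists_equiv_res
    exact ((extOneVanishes_res_iff hI).2 (hN.ext Z' hZ')).congr_right f.symm

end Restriction

section SupportIdempotent

theorem mem_idealGen_self (e : A) : e ∈ idealGen e :=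
  TwoSidedIdeal.mem_asIdeal.2 (TwoSidedIdeal.subset_span rfl)

theorem smul_eq_zero_of_mem_idealGen {e : A} {M : Type*} [AddCommGroup M] [Module A M]
    (h : ∀ m : M, e • m = 0) {a : A} (ha : a ∈ idealGen e) (m : M) : a • m = 0 := by
  have hle : TwoSidedIdeal.span {e} ≤ TwoSidedIdeal.ker (Module.toAddMonoidEnd A M) := by
    rw [TwoSidedIdeal.span_le, Set.singleton_subset_iff]
    exact (TwoSidedIdeal.mem_ker _).2 (AddMonoidHom.ext h)
  exact DFunLike.congr_fun ((TwoSidedIdeal.mem_ker _).1 (hle (TwoSidedIdeal.mem_asIdeal.1 ha))) m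

-- The element `e = e * e` kills the left module `A ⧸ (AeA)²`, hence so does `AeA`.
theorem isIdempotentElem_idealGen {e : A} (he : IsIdempotentElem e) :
    IsIdempotentElem (idealGen e) := by
  refine le_antisymm Ideal.mul_le_left fun a ha => ?_
  have hkill (m : A ⧸ (idealGen e * idealGen e)) : e • m = 0 := by
    obtain ⟨b, rfl⟩ := Submodule.mkQ_surjective _ m
    have heb : e * b = e * (e * b) := by rw [← mul_assoc, he.eq]
    rw [← map_smul, Submodule.mkQ_apply, Submodule.Quotient.mk_eq_zero, smul_eq_mul, heb]
    exact Ideal.mul_mem_mul (mem_idealGen_self e)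
      (Ideal.mul_mem_right b _ (mem_idealGen_self e))
  have h := smul_eq_zero_of_mem_idealGen hkill ha (Submodule.Quotient.mk 1)
  rwa [← Submodule.Quotient.mk_smul, Submodule.Quotient.mk_eq_zero, smul_eq_mul, mul_one] at h

theorem span_singleton_lt_span_singleton_add {e f : A} (he : IsIdempotentElem e)
    (hef : e * f = 0) (hfe : f * e = 0) (hf : f ≠ 0) :
    Submodule.span A {e} < Submodule.span A {e + f} := by
  refine lt_of_le_not_ge ?_ fun hle => hf ?_
  · rw [Submodule.span_singleton_le_iff_mem, Submodule.mem_span_singleton]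
    exact ⟨e, by rw [smul_eq_mul, mul_add, he.eq, hef, add_zero]⟩
  · rw [Submodule.span_singleton_le_iff_mem, Submodule.mem_span_singleton] at hle
    obtain ⟨a, ha⟩ := hle
    have h : (e + f) * e = e + f := by rw [← ha, smul_eq_mul, mul_assoc, he.eq]
    rw [add_mul, he.eq, hfe, add_zero] at h
    exact left_eq_add.1 h

theorem exists_map_isIdempotentElem {P : Type*} [AddCommGroup P] [Module A P]
    [Module.Projective A P] {e : A} (he : IsIdempotentElem e) {x : P} (hx : e • x = 0)
    (hsurj : Function.Surjective (LinearMap.toSpanSingleton A P x)) :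
    ∃ β : P →ₗ[A] A, IsIdempotentElem (β x) ∧ e * β x = 0 ∧ β x * e = 0 ∧ β x • x = x := by
  obtain ⟨γ, hγ⟩ := Module.projective_lifting_property _ LinearMap.id hsurj
  let β : P →ₗ[A] A := LinearMap.toSpanSingleton A A (1 - e) ∘ₗ γ
  have hβ (z : P) : β z • x = z := by
    change (γ z * (1 - e)) • x = z
    rw [mul_smul, sub_smul, one_smul, hx, sub_zero]
    exact LinearMap.congr_fun hγ z
  refine ⟨β, ?_, ?_, ?_, hβ x⟩
  · change β x • β x = β x
    rw [← map_smul, hβ]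
  · change e • β x = 0
    rw [← map_smul, hx, map_zero]
  · change γ x * (1 - e) * e = 0
    rw [mul_assoc, he.one_sub_mul_self, mul_zero]

theorem IsProjectiveCover.surjective_of_comp {Q P M : Type*} [AddCommGroup Q] [Module A Q]
    [AddCommGroup P] [Module A P] [AddCommGroup M] [Module A M] {π : P →ₗ[A] M}
    (hπ : IsProjectiveCover π) {α : Q →ₗ[A] P} (h : Function.Surjective (π ∘ₗ α)) :
    Function.Surjective α := by
  refine LinearMap.range_eq_top.1 (hπ.superfluous _ ?_)
  rw [← Submodule.comap_map_eq, ← LinearMap.range_comp, LinearMap.range_eq_top.2 h,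
    Submodule.comap_top]

theorem IsProjectiveCover.exists_gen_injective {P S M : FGModuleCat.{u} A} {π : P →ₗ[A] S}
    (hπ : IsProjectiveCover π) (hS : IsSimpleModule A S) {w : P →ₗ[A] M} (hw : w ≠ 0) :
    ∃ (Z : FGModuleCat.{u} A) (i : S →ₗ[A] Z), Gen M Z ∧ Function.Injective i := by
  let U := (LinearMap.ker π).map w
  obtain ⟨i, hi⟩ := exists_comp_eq_of_exact (LinearMap.exact_subtype_ker_map π) hπ.surjective
    (U.mkQ ∘ₗ w) (LinearMap.ext fun x => (Submodule.Quotient.mk_eq_zero U).2 ⟨x, x.2, rfl⟩)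
  refine ⟨FGModuleCat.of A (M ⧸ U), i, gen_self.of_surjective
    (Y := FGModuleCat.of A (M ⧸ U)) U.mkQ_surjective, LinearMap.injective_of_ne_zero ?_⟩
  rintro rfl
  refine hw (hπ.superfluous.eq_zero_of_range_le_map ?_)
  rintro _ ⟨x, rfl⟩
  exact (Submodule.Quotient.mk_eq_zero U).1 (LinearMap.congr_fun hi x).symm

-- Among the idempotents annihilating `M`, choose `e` with `Ae` maximal.
theorem exists_support_idempotent [IsArtinianRing A] (M : FGModuleCat.{u} A) :
    ∃ e : A, IsIdempotentElem e ∧ (∀ m : M, e • m = 0) ∧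
      ∀ S : FGModuleCat.{u} A, IsSimpleModule A S → (∀ s : S, e • s = 0) →
        ∃ (Z : FGModuleCat.{u} A) (i : S →ₗ[A] Z), Gen M Z ∧ Function.Injective i := by
  obtain ⟨e, ⟨he, heM⟩, hmax⟩ := WellFounded.has_min
    (InvImage.wf (fun e : A => Submodule.span A {e}) wellFounded_gt)
    {e | IsIdempotentElem e ∧ ∀ m : M, e • m = 0} ⟨0, IsIdempotentElem.zero, zero_smul A⟩
  refine ⟨e, he, heM, fun S hS heS => ?_⟩
  obtain ⟨P, π, hπ⟩ := exists_projectiveCover S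
  have := hπ.projective
  have := hS.nontrivial
  by_contra hno
  have hPM (w : P →ₗ[A] M) : w = 0 := by_contra fun hw => hno (hπ.exists_gen_injective hS hw)
  obtain ⟨s, hs⟩ := exists_ne (0 : S)
  obtain ⟨y, rfl⟩ := hπ.surjective s
  obtain ⟨x, hex, hx⟩ : ∃ x : P, e • x = 0 ∧ π x ≠ 0 := by
    refine ⟨(1 - e) • y, by rw [← mul_smul, he.mul_one_sub_self, zero_smul], ?_⟩
    rwa [map_smul, sub_smul, one_smul, heS, sub_zero]
  have hgen : Function.Surjective (LinearMap.toSpanSingleton A P x) := by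
    refine hπ.surjective_of_comp ?_
    rw [LinearMap.comp_toSpanSingleton]
    exact IsSimpleModule.toSpanSingleton_surjective A hx
  obtain ⟨β, hβ, heβ, hβe, hβx⟩ := exists_map_isIdempotentElem he hex hgen
  refine hmax (e + β x) ⟨he.add hβ (by rw [heβ, hβe, add_zero]), fun m => ?_⟩
    (span_singleton_lt_span_singleton_add he heβ hβe fun h => hx ?_)
  · rw [add_smul, heM, zero_add]
    exact LinearMap.congr_fun (hPM (LinearMap.toSpanSingleton A M m ∘ₗ β)) x
  · rw [← hβx, h, zero_smul, map_zero]

theorem isSupportTauTilting_iff_isSilting (k : Type v) [Field k] [Algebra k A] [Module.Finite k A]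
    (M : FGModuleCat.{u} A) : IsSupportTauTilting k M ↔ IsSilting M := by
  have : IsArtinianRing A := IsArtinianRing.of_finite k A
  constructor
  · rintro ⟨e, he, N, hN, φ, hφ⟩
    let f : M →ₗ[A] res (idealGen e) N :=
      { toFun := φ, map_add' := φ.map_add, map_smul' := φ.map_smulₛₗ }
    exact (isSilting_congr (LinearEquiv.ofBijective f hφ)).2
      ((isSilting_res_iff (isIdempotentElem_idealGen he)).2 hN.isSilting)
  · intro hM
    obtain ⟨e, he, heM, hsimple⟩ := exists_support_idempotent M
    obtain ⟨N, ⟨f⟩⟩ := exists_equiv_res fun a ha m =>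
      smul_eq_zero_of_mem_idealGen (e := e) (M := M) heM ha m
    have hN : IsSilting N :=
      (isSilting_res_iff (isIdempotentElem_idealGen he)).1 ((isSilting_congr f).1 hM)
    refine ⟨e, he, N, hN.isTauTilting k fun S hS => ?_,
      { toFun := f, map_add' := f.map_add, map_smul' := f.map_smul }, f.bijective⟩
    obtain ⟨Z, i, hZ, hi⟩ := hsimple (res (idealGen e) S) (isSimpleModule_res hS)
      (smul_res_eq_zero (mem_idealGen_self e))
    obtain ⟨Z', hZ', ⟨g⟩⟩ :=
      ((gen_of_addClosure (addClosure_of_equiv f.symm)).trans hZ).exists_equiv_res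
    exact ⟨Z', unresMap (g.toLinearMap ∘ₗ i), hZ', g.injective.comp hi⟩

end SupportIdempotent

end WeakCotorsion

theorem theorem4 (k : Type v) [Field k] (A : Type u) [Ring A] [Algebra k A]
    [Module.Finite k A] :
    Set.BijOn WeakCotorsion.tripleMap (WeakCotorsion.basicSupportTauTilting k A)
        {t | WeakCotorsion.IsLwCotorsionTorsion t} ∧
      (∀ (t : WeakCotorsion.SubcatTriple A), WeakCotorsion.IsLwCotorsionTorsion t →
        ∀ T : FGModuleCat.{u} A, WeakCotorsion.IsBasic T →
          (WeakCotorsion.addClosure T = t.C ⊓ t.T ↔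
            WeakCotorsion.IsSupportTauTilting k T ∧ WeakCotorsion.tripleOf T = t)) ∧
      WeakCotorsion.basicTilting A ⊆ WeakCotorsion.basicSupportTauTilting k A ∧
      Set.BijOn WeakCotorsion.tripleMap (WeakCotorsion.basicTilting A)
        {t | WeakCotorsion.IsCotorsionTorsion t} := by
  have : IsArtinianRing A := IsArtinianRing.of_finite k A
  have hbasic : WeakCotorsion.basicSupportTauTilting k A = WeakCotorsion.isoClass ''
      {T : FGModuleCat.{u} A | WeakCotorsion.IsBasic T ∧ WeakCotorsion.IsSilting T} := by
    simp only [WeakCotorsion.basicSupportTauTilting,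
      WeakCotorsion.isSupportTauTilting_iff_isSilting k]
  rw [hbasic]
  refine ⟨WeakCotorsion.bijOn_tripleMap_isSilting, fun t ht T _ => ?_, ?_,
    WeakCotorsion.bijOn_tripleMap_basicTilting⟩
  · rw [WeakCotorsion.isSupportTauTilting_iff_isSilting k]
    exact WeakCotorsion.addClosure_eq_iff_isSilting_and_tripleOf_eq ht
  · exact Set.image_mono fun T hT => ⟨hT.1, hT.2.isSilting⟩
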